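/- Let $n\ge 1$. Let $\mathrm{Conv}_{c,n}(\mathbb R^n)$ be the set of all functions $u:\mathbb R^n\to\mathbb R\cup\{+\infty\}$ that are proper ($u\not\equiv+\infty$), lower semicontinuous, convex and coercive ($\lim_{|x|\to\infty}u(x)=+\infty$) and whose domain $\operatorname{dom}u=\{x: u(x)<+\infty\}$ has dimension $n$. Let $M^{n-1}$ be the set of all continuous, strictly decreasing functions $\zeta:\mathbb R\to(0,\infty)$ with $\int_0^\infty \zeta(t)\,t^{n-1}\,dt<+\infty$. For $\zeta\in M^{n-1}$ and $u,v\in\mathrm{Conv}_{c,n}(\mathbb R^n)$ put $$\delta_{\zeta,1}(u,v)=\int_{\mathbb R^n}|\zeta(u(x))-\zeta(v(x))|\,dx,$$ where $\zeta(+\infty):=0$. A map $I:\mathrm{Conv}_{c,n}(\mathbb R^n)\to\mathrm{Conv}_{c,n}(\mathbb R^n)$ is called an isometry for $\delta_{\zeta,1}$ if $\delta_{\zeta,1}(I(u),I(v))=\delta_{\zeta,1}(u,v)$ for all $u,v\in\mathrm{Conv}_{c,n}(\mathbb R^n)$ (no surjectivity is assumed). Then a map $I:\mathrm{Conv}_{c,n}(\mathbb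 R^n)\to\mathrm{Conv}_{c,n}(\mathbb R^n)$ is an isometry for $\delta_{\zeta,1}$ for every $\zeta\in M^{n-1}$ if and only if there exist $\phi\in\mathrm{GL}(n)$ with $|\det\phi|=1$ and $x_0\in\mathbb R^n$ such that $$I(u)=u\circ\alpha^{-1}\qquad\text{for every }u\in\mathrm{Conv}_{c,n}(\mathbb R^n),$$ where $\alpha(x)=\phi(x)+x_0$ for $x\in\mathbb R^n$. -/

import Mathlib

open MeasureTheory Filter Topology

/-- `u : ℝⁿ → ℝ ∪ {+∞}` (values in `EReal` which avoid `⊥ = -∞`) is a proper, lower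
semicontinuous, coercive, convex function whose domain `{u < +∞}` has dimension `n`. -/
structure IsCoerciveConvexFullDim (n : ℕ) (u : EuclideanSpace ℝ (Fin n) → EReal) : Prop where
  ne_bot : ∀ x, u x ≠ ⊥
  proper : ∃ x, u x ≠ ⊤
  lsc : LowerSemicontinuous u
  coercive : Tendsto u (cocompact (EuclideanSpace ℝ (Fin n))) (𝓝 ⊤)
  convex : ∀ x y : EuclideanSpace ℝ (Fin n), ∀ a b : ℝ, 0 < a → 0 < b → a + b = 1 →
    u (a • x + b • y) ≤ (a : EReal) * u x + (b : EReal) * u y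
  full_dim : Module.finrank ℝ (vectorSpan ℝ {x | u x < ⊤}) = n

/-- The space of proper, lower semicontinuous, coercive, convex functions
`ℝⁿ → ℝ ∪ {+∞}` with `n`-dimensional domain. -/
abbrev CoerciveConvexFullDim (n : ℕ) : Type :=
  {u : EuclideanSpace ℝ (Fin n) → EReal // IsCoerciveConvexFullDim n u}

/-- The class `M^{n-1}` (for `n ≥ 1`): continuous, strictly decreasing `ζ : ℝ → (0, ∞)` with
finite moment of order `n - 1`, that is `∫₀^∞ ζ(t) t^{n-1} dt < ∞`. -/
structure IsMomentClass (n : ℕ) (ζ : ℝ → ℝ) : Prop where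
  pos : ∀ t, 0 < ζ t
  continuous : Continuous ζ
  strictAnti : StrictAnti ζ
  finite_moment : IntegrableOn (fun t : ℝ => ζ t * t ^ (n - 1)) (Set.Ioi 0)

open Classical in
/-- Evaluation of `ζ` on `ℝ ∪ {+∞}` with the convention `ζ(+∞) = 0`.
(The value at `⊥` is irrelevant.) -/
noncomputable def zetaEval (ζ : ℝ → ℝ) (t : EReal) : ℝ :=
  if t = ⊤ then 0 else ζ t.toReal

/-- `δ_{ζ,1}(u, v) = ‖ζ(u) - ζ(v)‖₁ = ∫ |ζ(u(x)) - ζ(v(x))| dx`, as an element of `[0, ∞]`. -/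
noncomputable def deltaZeta {n : ℕ} (ζ : ℝ → ℝ) (u v : CoerciveConvexFullDim n) : ENNReal :=
  eLpNorm (fun x => zetaEval ζ (u.1 x) - zetaEval ζ (v.1 x)) 1 volume

/-- `I` is an isometry (a distance preserving map, not assumed onto) for `δ_{ζ,1}`. -/
def IsDeltaIsometry {n : ℕ} (ζ : ℝ → ℝ)
    (I : CoerciveConvexFullDim n → CoerciveConvexFullDim n) : Prop :=
  ∀ u v, deltaZeta ζ (I u) (I v) = deltaZeta ζ u v

/-- The affine bijection `α(x) = φ(x) + x₀` of `ℝⁿ`, for `φ ∈ GL(n)`. -/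
noncomputable def affinity {n : ℕ}
    (φ : EuclideanSpace ℝ (Fin n) ≃ₗ[ℝ] EuclideanSpace ℝ (Fin n))
    (x₀ : EuclideanSpace ℝ (Fin n)) :
    EuclideanSpace ℝ (Fin n) ≃ EuclideanSpace ℝ (Fin n) :=
  φ.toEquiv.trans (Equiv.addRight x₀)

theorem affinity_apply {n : ℕ}
    (φ : EuclideanSpace ℝ (Fin n) ≃ₗ[ℝ] EuclideanSpace ℝ (Fin n))
    (x₀ x : EuclideanSpace ℝ (Fin n)) : affinity φ x₀ x = φ x + x₀ := rfl

/-! The affinities preserve volume, so one implication is a change of variables. For the other,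
exp(-s) plus any `ramp t k` lies in the moment class. Since all the profiles decrease, distances add
in ζ, and the finite exponential part cancels: `I` preserves the distances of the ramps. As k → ∞
the ramps tend to the indicator of (-∞, t], so `I` preserves the volume of the symmetric difference
of sublevel sets at every level t (`volume_symmDiff_sublevel`).

Suppose that at level t empty sublevel sets go to null sets. Then `I` preserves volumes of
t-sublevel sets, hence volumes of their intersections. The geometric core is
`PreservesInter.exists_affineEquiv`: such a map f of convex bodies comes from a volume preserving
affinity. Indeed f is monotone and compatible with decreasing intersections, so there is a point map
g with g x ∈ f K whenever x ∈ K. Bodies that overlap in a null set have images separated by a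
hyperplane, and this forces f to send a simplex to the simplex spanned by the g-images of its
vertices (`map_simplex`). Barycentric coordinates are volume ratios, so g respects them
(`map_barycentric`) and is affine.

Two points remain. Empty sublevel sets do go to null sets, since otherwise some sublevel set would
be convex and disconnected (`volume_sublevel_eq_zero`). And the affinity does not depend on t,
because a function constant on a body has the same sublevel set at all levels above that constant.
The sublevel sets then determine `I u`. -/

set_option linter.unusedSectionVars false

/-! ### Convex bodies: relations up to null sets are exact -/

/-- A compact convex set with nonempty interior. -/
structure IsSolidBody {E : Type*} [NormedAddCommGroup E] [NormedSpace ℝ E] (K : Set E) : Prop where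
  convex : Convex ℝ K
  isCompact : IsCompact K
  interior_nonempty : (interior K).Nonempty

section Bodies

variable {E : Type*} [NormedAddCommGroup E] [NormedSpace ℝ E]

theorem IsSolidBody.closure_interior {K : Set E} (hK : IsSolidBody K) :
    closure (interior K) = K := by
  rw [hK.convex.closure_interior_eq_closure_of_nonempty_interior hK.interior_nonempty,
    hK.isCompact.isClosed.closure_eq]

theorem isSolidBody_closedBall [FiniteDimensional ℝ E] (x : E) {r : ℝ} (hr : 0 < r) :
    IsSolidBody (Metric.closedBall x r) :=
  ⟨convex_closedBall x r, isCompact_closedBall x r,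
    ⟨x, Metric.ball_subset_interior_closedBall (Metric.mem_ball_self hr)⟩⟩

theorem IsSolidBody.cthickening [FiniteDimensional ℝ E] {K : Set E} (hK : IsSolidBody K) (r : ℝ) :
    IsSolidBody (Metric.cthickening r K) :=
  ⟨hK.convex.cthickening r, hK.isCompact.cthickening,
    hK.interior_nonempty.mono (interior_mono (Metric.self_subset_cthickening K))⟩

theorem IsSolidBody.image_affineEquiv {K : Set E} (hK : IsSolidBody K) [FiniteDimensional ℝ E]
    (A : E ≃ᵃ[ℝ] E) : IsSolidBody (A '' K) := by
  refine ⟨hK.convex.affine_image A.toAffineMap,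
    hK.isCompact.image A.toAffineMap.continuous_of_finiteDimensional, ?_⟩
  have h : A '' interior K = interior (A '' K) :=
    (AffineEquiv.toContinuousAffineEquiv A).toHomeomorph.image_interior K
  rw [← h]
  exact hK.interior_nonempty.image _

variable [FiniteDimensional ℝ E] [MeasurableSpace E] [BorelSpace E]
  {μ : Measure E} [μ.IsAddHaarMeasure]

theorem IsSolidBody.measure_ne_zero {K : Set E} (hK : IsSolidBody K) : μ K ≠ 0 :=
  (Measure.measure_pos_of_nonempty_interior μ hK.interior_nonempty).ne'

theorem IsSolidBody.measure_ne_top {K : Set E} (hK : IsSolidBody K) : μ K ≠ ⊤ :=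
  hK.isCompact.measure_lt_top.ne

theorem isSolidBody_of_measure_ne_zero {K : Set E} (hc : Convex ℝ K) (hk : IsCompact K)
    (h : μ K ≠ 0) : IsSolidBody K := by
  refine ⟨hc, hk, ?_⟩
  by_contra hi
  rw [Set.not_nonempty_iff_eq_empty] at hi
  apply h
  have := hc.addHaar_frontier μ
  rwa [hk.isClosed.frontier_eq, hi, Set.sdiff_empty] at this

/-- An open null set is empty, so `L` contains the interior of `K`, and `K` is the closure of its
interior. This is what turns measure identities into set identities throughout. -/
theorem IsSolidBody.subset_of_measure_diff {K L : Set E} (hK : IsSolidBody K) (hL : IsClosed L)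
    (h : μ (K \ L) = 0) : K ⊆ L := by
  have h1 : interior K \ L = ∅ := by
    have ho : IsOpen (interior K \ L) := isOpen_interior.sdiff hL
    rw [← ho.measure_eq_zero_iff μ]
    exact measure_mono_null (Set.sdiff_subset_sdiff_left interior_subset) h
  rw [← hK.closure_interior]
  exact closure_minimal (Set.sdiff_eq_empty.mp h1) hL

theorem measure_diff_eq_zero_iff {A B : Set E} (hA : μ A ≠ ⊤) (hB : MeasurableSet B) :
    μ (A \ B) = 0 ↔ μ (A ∩ B) = μ A := by
  have h := measure_inter_add_sdiff (μ := μ) A hB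
  constructor
  · intro h0
    rwa [h0, add_zero] at h
  · intro h1
    rw [h1] at h
    exact (ENNReal.add_right_inj hA).mp (h.trans (add_zero _).symm)

theorem IsSolidBody.eq_of_subset_of_measure_le {K L : Set E} (hL : IsSolidBody L)
    (hK : IsClosed K) (h : K ⊆ L) (hm : μ L ≤ μ K) : K = L := by
  refine h.antisymm (hL.subset_of_measure_diff (μ := μ) hK ?_)
  rw [measure_diff_eq_zero_iff hL.measure_ne_top hK.measurableSet,
    Set.inter_eq_self_of_subset_right h]
  exact le_antisymm (measure_mono h) hm

theorem IsSolidBody.disjoint_interior {K L : Set E} (h : μ (K ∩ L) = 0) :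
    Disjoint (interior K) (interior L) := by
  rw [Set.disjoint_iff_inter_eq_empty, ← interior_inter, ← isOpen_interior.measure_eq_zero_iff μ]
  exact measure_mono_null interior_subset h

end Bodies

/-! ### Simplices and their volumes -/

section Simplices

variable {E : Type*} [NormedAddCommGroup E] [NormedSpace ℝ E] [FiniteDimensional ℝ E]
  [MeasurableSpace E] [BorelSpace E] {μ : Measure E} [μ.IsAddHaarMeasure] {ι : Type*} [Fintype ι]

theorem measure_image_affineMap (μ : Measure E) [μ.IsAddHaarMeasure] (A : E →ᵃ[ℝ] E) (K : Set E) :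
    μ (A '' K) = ENNReal.ofReal |LinearMap.det A.linear| * μ K := by
  have : A '' K = (fun y => y + A 0) '' (A.linear '' K) := by
    rw [Set.image_image]
    refine Set.image_congr fun y _ => ?_
    rw [A.decomp]
    simp
  rw [this, Set.image_add_right, measure_preimage_add_right, Measure.addHaar_image_linearMap]

theorem isSolidBody_simplex (b : AffineBasis ι ℝ E) : IsSolidBody (convexHull ℝ (Set.range b)) :=
  ⟨convex_convexHull ℝ _, (Set.finite_range b).isCompact_convexHull ℝ,
    interior_convexHull_nonempty_iff_affineSpan_eq_top.mpr b.tot⟩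

theorem exists_affineBasis_of_measure_ne_zero (hc : Fintype.card ι = Module.finrank ℝ E + 1)
    (p : ι → E) (h : μ (convexHull ℝ (Set.range p)) ≠ 0) :
    ∃ b : AffineBasis ι ℝ E, ⇑b = p := by
  have hs := isSolidBody_of_measure_ne_zero (convex_convexHull ℝ (Set.range p))
    ((Set.finite_range p).isCompact_convexHull ℝ) h
  have ht := interior_convexHull_nonempty_iff_affineSpan_eq_top.mp hs.interior_nonempty
  refine ⟨⟨p, ?_, ht⟩, rfl⟩
  rw [affineIndependent_iff_finrank_vectorSpan_eq ℝ p hc, ← direction_affineSpan, ht,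
    AffineSubspace.direction_top, finrank_top]

/-- The affine map y ↦ y + bᵢ*(y)(x - bᵢ), with bᵢ* the i-th barycentric coordinate, fixes the other
vertices and moves `b i` to `x`. Its linear part is a transvection of determinant 1 + bᵢ*(x) -
bᵢ*(bᵢ) = bᵢ*(x). -/
theorem measure_simplex_update [DecidableEq ι] (b : AffineBasis ι ℝ E) (i : ι) (x : E) :
    μ (convexHull ℝ (Set.range (Function.update b i x))) =
      ENNReal.ofReal |b.coord i x| * μ (convexHull ℝ (Set.range b)) := by
  let T : E →ᵃ[ℝ] E :=
    { toFun := fun y => y + b.coord i y • (x - b i)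
      linear := LinearMap.transvection (b.coord i).linear (x - b i)
      map_vadd' := by
        intro p v
        simp only [vadd_eq_add, LinearMap.transvection.apply]
        have : b.coord i (v + p) = (b.coord i).linear v + b.coord i p := by
          simpa using (b.coord i).map_vadd p v
        rw [this, add_smul]
        abel }
  have hT : ∀ y, T y = y + b.coord i y • (x - b i) := fun _ => rfl
  have h1 : Function.update b i x = T ∘ b := by
    ext j
    by_cases h : j = i
    · subst h
      simp [hT]
    · simp [hT, h, b.coord_apply_ne (Ne.symm h)]
  have h2 : LinearMap.det T.linear = b.coord i x := by
    change LinearMap.det (LinearMap.transvection (b.coord i).linear (x - b i)) = _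
    rw [LinearMap.transvection.det]
    have : (b.coord i).linear (x - b i) = b.coord i x - b.coord i (b i) := by
      simpa using (b.coord i).linearMap_vsub x (b i)
    rw [this]
    simp
  rw [h1, Set.range_comp, ← T.image_convexHull, measure_image_affineMap, h2]

end Simplices

/-! ### Maps of bodies that preserve the measure of intersections -/

/-- `f` maps solid bodies to solid bodies and preserves the measure of their intersections. -/
structure PreservesInter {E : Type*} [NormedAddCommGroup E] [NormedSpace ℝ E] [MeasurableSpace E]
    (μ : Measure E) (f : Set E → Set E) : Prop where
  isSolidBody : ∀ K, IsSolidBody K → IsSolidBody (f K)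
  measure_inter : ∀ K L, IsSolidBody K → IsSolidBody L → μ (f K ∩ f L) = μ (K ∩ L)

namespace PreservesInter

variable {E : Type*} [NormedAddCommGroup E] [NormedSpace ℝ E] [FiniteDimensional ℝ E]
  [MeasurableSpace E] [BorelSpace E] {μ : Measure E} [μ.IsAddHaarMeasure] {f : Set E → Set E}

theorem measure_eq (hf : PreservesInter μ f) {K : Set E} (hK : IsSolidBody K) : μ (f K) = μ K := by
  simpa using hf.measure_inter K K hK hK

theorem mono (hf : PreservesInter μ f) {K L : Set E} (hK : IsSolidBody K) (hL : IsSolidBody L)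
    (h : K ⊆ L) : f K ⊆ f L := by
  have hfL := hf.isSolidBody L hL
  refine (hf.isSolidBody K hK).subset_of_measure_diff (μ := μ) hfL.isCompact.isClosed ?_
  rw [measure_diff_eq_zero_iff (hf.isSolidBody K hK).measure_ne_top hfL.isCompact.measurableSet,
    hf.measure_inter K L hK hL, hf.measure_eq hK, Set.inter_eq_self_of_subset_left h]

/-- The intersection of the images contains `f L` by monotonicity and has the same measure by
continuity from above, so the two bodies coincide. -/
theorem iInter_subset (hf : PreservesInter μ f) {K : ℕ → Set E} {L : Set E}
    (hK : ∀ j, IsSolidBody (K j)) (hL : IsSolidBody L) (ha : Antitone K) (h : ⋂ j, K j = L) :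
    ⋂ j, f (K j) ⊆ f L := by
  have hfK := fun j => hf.isSolidBody (K j) (hK j)
  have hfL := hf.isSolidBody L hL
  have hsub : f L ⊆ ⋂ j, f (K j) :=
    Set.subset_iInter fun j => hf.mono hL (hK j) (h ▸ Set.iInter_subset K j)
  have hcl : IsClosed (⋂ j, f (K j)) := isClosed_iInter fun j => (hfK j).isCompact.isClosed
  have hsol : IsSolidBody (⋂ j, f (K j)) :=
    ⟨convex_iInter fun j => (hfK j).convex,
      (hfK 0).isCompact.of_isClosed_subset hcl (Set.iInter_subset _ 0),
      hfL.interior_nonempty.mono (interior_mono hsub)⟩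
  refine (hsol.eq_of_subset_of_measure_le (μ := μ) hfL.isCompact.isClosed hsub ?_).ge
  have hfa : Antitone fun j => f (K j) := fun i j hij => hf.mono (hK j) (hK i) (ha hij)
  have h1 : μ (⋂ j, f (K j)) = ⨅ j, μ (f (K j)) :=
    hfa.measure_iInter (fun j => (hfK j).isCompact.measurableSet.nullMeasurableSet)
      ⟨0, (hfK 0).measure_ne_top⟩
  have h2 : μ (⋂ j, K j) = ⨅ j, μ (K j) :=
    ha.measure_iInter (fun j => (hK j).isCompact.measurableSet.nullMeasurableSet)
      ⟨0, (hK 0).measure_ne_top⟩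
  rw [h1, hf.measure_eq hL, ← h, h2]
  exact (iInf_congr fun j => hf.measure_eq (hK j)).le

/-- A point selection compatible with `f`. -/
theorem exists_selection (hf : PreservesInter μ f) :
    ∃ g : E → E, ∀ K, IsSolidBody K → ∀ x ∈ K, g x ∈ f K := by
  have hr : ∀ j : ℕ, (0 : ℝ) < 1 / (j + 1) := fun j => by positivity
  have hanti : Antitone fun j : ℕ => (1 : ℝ) / (j + 1) := fun i j hij =>
    one_div_le_one_div_of_le (by positivity) (by exact_mod_cast Nat.succ_le_succ hij)
  have hball : ∀ (x : E) (j : ℕ), IsSolidBody (Metric.closedBall x ((1 : ℝ) / (j + 1))) :=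
    fun x j => isSolidBody_closedBall x (hr j)
  -- The value at `x` is any point common to the images of the balls shrinking to `x`. For `x ∈ K`
  -- these balls lie in the thickenings of `K`, whose images shrink to `f K`.
  have hne : ∀ x, (⋂ j : ℕ, f (Metric.closedBall x (1 / (j + 1)))).Nonempty := by
    intro x
    have hs := fun j => hf.isSolidBody _ (hball x j)
    refine IsCompact.nonempty_iInter_of_sequence_nonempty_isCompact_isClosed _ ?_ ?_
      (hs 0).isCompact fun j => (hs j).isCompact.isClosed
    · exact fun j => hf.mono (hball x (j + 1)) (hball x j)
        (Metric.closedBall_subset_closedBall (hanti j.le_succ))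
    · exact fun j => (hs j).interior_nonempty.mono interior_subset
  choose g hg using hne
  refine ⟨g, fun K hK x hx => ?_⟩
  refine hf.iInter_subset (K := fun j : ℕ => Metric.cthickening (1 / (j + 1)) K)
    (fun j => hK.cthickening _) hK (fun i j hij => Metric.cthickening_mono (hanti hij) K) ?_ ?_
  · refine (Set.Subset.antisymm (fun y hy => ?_)
      (Set.subset_iInter fun j => Metric.self_subset_cthickening K))
    rw [← hK.isCompact.isClosed.closure_eq, Metric.closure_eq_iInter_cthickening]
    refine Set.mem_iInter₂.mpr fun ε hε => ?_
    obtain ⟨j, hj⟩ := exists_nat_one_div_lt hε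
    exact Metric.cthickening_mono hj.le K (Set.mem_iInter.mp hy j)
  · refine Set.mem_iInter.mpr fun j => ?_
    exact hf.mono (hball x j) (hK.cthickening _) (Metric.closedBall_subset_cthickening hx _)
      (Set.mem_iInter.mp (hg x) j)

/-- Two solid bodies meeting in a null set have images on different sides of a hyperplane. -/
theorem exists_separation (hf : PreservesInter μ f) {K L : Set E} (hK : IsSolidBody K)
    (hL : IsSolidBody L) (h : μ (K ∩ L) = 0) :
    ∃ (l : E →L[ℝ] ℝ) (s : ℝ), (∀ y ∈ interior (f K), s < l y) ∧ (∀ y ∈ interior (f L), l y < s) ∧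
      (∀ y ∈ f K, s ≤ l y) ∧ ∀ y ∈ f L, l y ≤ s := by
  have hfK := hf.isSolidBody K hK
  have hfL := hf.isSolidBody L hL
  obtain ⟨l, s, h1, h2⟩ := geometric_hahn_banach_open_open hfL.convex.interior isOpen_interior
    hfK.convex.interior isOpen_interior
    (IsSolidBody.disjoint_interior (μ := μ) (by rwa [hf.measure_inter L K hL hK, Set.inter_comm]))
  refine ⟨l, s, h2, h1, ?_, ?_⟩
  · have hc : IsClosed {y | s ≤ l y} := isClosed_le continuous_const l.continuous
    have := closure_minimal (fun y hy => (h2 y hy).le) hc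
    rwa [hfK.closure_interior] at this
  · have hc : IsClosed {y | l y ≤ s} := isClosed_le l.continuous continuous_const
    have := closure_minimal (fun y hy => (h1 y hy).le) hc
    rwa [hfL.closure_interior] at this

end PreservesInter

/-! ### Sign patterns of barycentric coordinates and images of simplices -/

section Orthants

variable {E : Type*} [NormedAddCommGroup E] [NormedSpace ℝ E] [FiniteDimensional ℝ E]
  {ι : Type*} [Fintype ι]

/-- For every sign pattern that is not everywhere negative there is a point whose barycentric
coordinates have these signs. -/
theorem AffineBasis.exists_coord_sign (b : AffineBasis ι ℝ E) (ε : ι → Bool) (i₀ : ι)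
    (h : ε i₀ = true) : ∃ x, ∀ i, if ε i then 0 < b.coord i x else b.coord i x < 0 := by
  classical
  let w₀ : ι → ℝ := fun i => if ε i then 1 else -1
  -- One weight this large keeps the total positive even if all the others are -1, so normalising
  -- does not change signs.
  let N : ℝ := Fintype.card ι + 1
  let w₁ : ι → ℝ := fun i => if i = i₀ then N else w₀ i
  have hw₁ : ∀ i, if ε i then 0 < w₁ i else w₁ i < 0 := by
    intro i
    have hN : 0 < N := by positivity
    by_cases hi : i = i₀
    · subst hi
      simpa [w₁, h] using hN
    · cases hε : ε i <;> simp [w₁, w₀, hi, hε]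
  have hsum : 0 < ∑ i, w₁ i := by
    have h1 : ∀ i, (if i = i₀ then N else 0) + (-1 : ℝ) ≤ w₁ i := by
      intro i
      by_cases hi : i = i₀
      · simp [w₁, hi]
      · cases hε : ε i <;> simp [w₁, w₀, hi, hε]
    have h2 := Finset.sum_le_sum fun i (_ : i ∈ Finset.univ) => h1 i
    rw [Finset.sum_add_distrib] at h2
    simp only [Finset.sum_ite_eq', Finset.mem_univ, if_true, Finset.sum_const, Finset.card_univ,
      nsmul_eq_mul] at h2
    simp only [N] at h2
    linarith
  let w : ι → ℝ := fun i => w₁ i / ∑ j, w₁ j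
  have hw : ∑ i, w i = 1 := by
    rw [← Finset.sum_div, div_self hsum.ne']
  refine ⟨Finset.univ.affineCombination ℝ b w, fun i => ?_⟩
  rw [b.coord_apply_combination_of_mem (Finset.mem_univ i) hw]
  have := hw₁ i
  cases hε : ε i
  · simpa [hε, w] using div_neg_of_neg_of_pos (by simpa [hε] using this) hsum
  · simpa [hε, w] using div_pos (by simpa [hε] using this) hsum

end Orthants

section Orthants

variable {E : Type*} [NormedAddCommGroup E] [NormedSpace ℝ E] [FiniteDimensional ℝ E]
  {ι : Type*} [Fintype ι]

/-- The part of a set where a barycentric coordinate has a prescribed sign. -/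
def AffineBasis.halfPart (b : AffineBasis ι ℝ E) (B : Set E) (s : Bool) (i : ι) : Set E :=
  B ∩ {y | if s then 0 ≤ b.coord i y else b.coord i y ≤ 0}

theorem AffineBasis.isClosed_coord_sign (b : AffineBasis ι ℝ E) (s : Bool) (i : ι) :
    IsClosed {y | if s then 0 ≤ b.coord i y else b.coord i y ≤ 0} := by
  have hc : Continuous (b.coord i) := (b.coord i).continuous_of_finiteDimensional
  cases s
  · simpa using isClosed_le hc continuous_const
  · simpa using isClosed_le continuous_const hc

theorem AffineBasis.convex_coord_sign (b : AffineBasis ι ℝ E) (s : Bool) (i : ι) :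
    Convex ℝ {y | if s then 0 ≤ b.coord i y else b.coord i y ≤ 0} := by
  cases s
  · exact (convex_Iic (0 : ℝ)).affine_preimage (b.coord i)
  · exact (convex_Ici (0 : ℝ)).affine_preimage (b.coord i)

theorem AffineBasis.isSolidBody_iInter_halfPart [Nonempty ι] (b : AffineBasis ι ℝ E) {B : Set E}
    (hB : IsSolidBody B) (ε : ι → Bool) {x : E} (hx : x ∈ interior B)
    (h : ∀ i, if ε i then 0 < b.coord i x else b.coord i x < 0) :
    IsSolidBody (⋂ i, b.halfPart B (ε i) i) := by
  have hcl : IsClosed (⋂ i, b.halfPart B (ε i) i) :=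
    isClosed_iInter fun i => hB.isCompact.isClosed.inter (b.isClosed_coord_sign _ i)
  refine ⟨convex_iInter fun i => hB.convex.inter (b.convex_coord_sign _ i),
    hB.isCompact.of_isClosed_subset hcl
      ((Set.iInter_subset _ (Classical.arbitrary ι)).trans Set.inter_subset_left), x, ?_⟩
  rw [mem_interior_iff_mem_nhds, Filter.iInter_mem]
  intro i
  refine Filter.inter_mem (mem_interior_iff_mem_nhds.mp hx) ?_
  have hc : Continuous (b.coord i) := (b.coord i).continuous_of_finiteDimensional
  have := h i
  cases hε : ε i
  · rw [hε] at this
    filter_upwards [hc.continuousAt.eventually_lt continuousAt_const (by simpa using this)]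
      with y hy
    simpa using hy.le
  · rw [hε] at this
    filter_upwards [continuousAt_const.eventually_lt hc.continuousAt (by simpa using this)]
      with y hy
    simpa using hy.le

theorem AffineBasis.measure_halfPart_inter [MeasurableSpace E] [BorelSpace E] (μ : Measure E)
    [μ.IsAddHaarMeasure] (b : AffineBasis ι ℝ E) (B : Set E) (i : ι) :
    μ (b.halfPart B true i ∩ b.halfPart B false i) = 0 := by
  let s : AffineSubspace ℝ E := (AffineSubspace.mk' (0 : ℝ) ⊥).comap (b.coord i)
  have hs : ∀ y, y ∈ s ↔ b.coord i y = 0 := by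
    intro y
    simp [s, AffineSubspace.mem_comap, AffineSubspace.mem_mk']
  have hne : s ≠ ⊤ := by
    intro h
    have : b i ∈ s := h ▸ AffineSubspace.mem_top ℝ E (b i)
    rw [hs] at this
    simp at this
  refine measure_mono_null (fun y hy => ?_) (Measure.addHaar_affineSubspace μ s hne)
  have h1 : 0 ≤ b.coord i y := by simpa using hy.1.2
  have h2 : b.coord i y ≤ 0 := by simpa using hy.2.2
  exact (hs y).mpr (le_antisymm h2 h1)

end Orthants

namespace PreservesInter

variable {E : Type*} [NormedAddCommGroup E] [NormedSpace ℝ E] [FiniteDimensional ℝ E]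
  [MeasurableSpace E] [BorelSpace E] {μ : Measure E} [μ.IsAddHaarMeasure] {f : Set E → Set E}
  {ι : Type*} [Fintype ι]

/-- Each facet hyperplane cuts a large ball into two halves whose images lie on different sides of a
hyperplane lᵢ = sᵢ. The functions lᵢ - sᵢ serve as barycentric coordinates, up to positive factors,
of the image: the sign patterns realised by bodies make them independent, and each g(bⱼ) lies on all
the hyperplanes with i ≠ j. -/
theorem map_simplex [Nontrivial E] (hf : PreservesInter μ f) {g : E → E}
    (hg : ∀ K, IsSolidBody K → ∀ x ∈ K, g x ∈ f K) (b : AffineBasis ι ℝ E) :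
    f (convexHull ℝ (Set.range b)) = convexHull ℝ (Set.range (g ∘ b)) := by
  classical
  have hS := isSolidBody_simplex b
  have hcard := b.card_eq_finrank_add_one
  have : Nontrivial ι := by
    rw [← Fintype.one_lt_card_iff_nontrivial, hcard]
    have := Module.finrank_pos (R := ℝ) (M := E)
    omega
  refine Set.Subset.antisymm ?_ (convexHull_min ?_ (hf.isSolidBody _ hS).convex)
  swap
  · rintro _ ⟨j, rfl⟩
    exact hg _ hS _ (subset_convexHull ℝ _ ⟨j, rfl⟩)
  have hP : ∀ ε : ι → Bool, ∃ x, (∃ i, ε i = true) →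
      ∀ i, if ε i then 0 < b.coord i x else b.coord i x < 0 := by
    intro ε
    by_cases h : ∃ i, ε i = true
    · obtain ⟨i, hi⟩ := h
      obtain ⟨x, hx⟩ := b.exists_coord_sign ε i hi
      exact ⟨x, fun _ => hx⟩
    · exact ⟨0, fun h' => (h h').elim⟩
  choose P hP using hP
  -- The ball must contain all vertices, and in its interior a point of every admissible sign
  -- pattern.
  let R : ℝ := 1 + (∑ ε, ‖P ε‖ + ∑ i, ‖b i‖)
  have hPR : ∀ ε, ‖P ε‖ < R := by
    intro ε
    have h1 := Finset.single_le_sum (fun ε _ => norm_nonneg (P ε)) (Finset.mem_univ ε)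
    have h2 : 0 ≤ ∑ i, ‖b i‖ := Finset.sum_nonneg fun i _ => norm_nonneg _
    simp only [R]
    linarith
  have hbR : ∀ i, ‖b i‖ ≤ R := by
    intro i
    have h1 := Finset.single_le_sum (fun i _ => norm_nonneg (b i)) (Finset.mem_univ i)
    have h2 : 0 ≤ ∑ ε, ‖P ε‖ := Finset.sum_nonneg fun i _ => norm_nonneg _
    simp only [R]
    linarith
  have hR : 0 < R := (norm_nonneg _).trans_lt (hPR fun _ => true)
  let B := Metric.closedBall (0 : E) R
  have hB : IsSolidBody B := isSolidBody_closedBall 0 hR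
  have horth : ∀ ε : ι → Bool, (∃ i, ε i = true) → IsSolidBody (⋂ i, b.halfPart B (ε i) i) := by
    intro ε h
    refine b.isSolidBody_iInter_halfPart hB ε ?_ (hP ε h)
    exact Metric.ball_subset_interior_closedBall (by simpa using hPR ε)
  have hhalf : ∀ s i, IsSolidBody (b.halfPart B s i) := by
    intro s i
    -- A second index can carry a positive sign, so each half contains an admissible orthant even
    -- when `s` is negative.
    obtain ⟨j, hj⟩ := exists_ne i
    have h := horth (Function.update (fun _ => true) i s) ⟨j, by simp [hj]⟩
    refine ⟨hB.convex.inter (b.convex_coord_sign s i), hB.isCompact.inter_right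
      (b.isClosed_coord_sign s i), h.interior_nonempty.mono (interior_mono ?_)⟩
    simpa using Set.iInter_subset
      (fun k => b.halfPart B (Function.update (fun _ => true) i s k) k) i
  have hsep := fun i => hf.exists_separation (hhalf true i) (hhalf false i)
    (b.measure_halfPart_inter μ B i)
  choose l s hpos hneg hnonneg hnonpos using hsep
  -- Homogenising makes the affine functions lᵢ - sᵢ linear and equates the dimensions of source and
  -- target.
  let Φ : E × ℝ →ₗ[ℝ] ι → ℝ := LinearMap.pi fun i =>
    (l i).toLinearMap ∘ₗ LinearMap.fst ℝ E ℝ - s i • LinearMap.snd ℝ E ℝ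
  have hΦ : ∀ y i, Φ (y, 1) i = l i y - s i := by
    intro y i
    simp [Φ]
  have key : ∀ ψ : (ι → ℝ) →ₗ[ℝ] ℝ, LinearMap.range Φ ≤ LinearMap.ker ψ →
      ∀ i, ψ (Pi.single i 1) ≤ 0 := by
    intro ψ hψ i
    by_contra! hi
    -- If ψ kills the range and has a positive coefficient, its own sign pattern is admissible. At
    -- an interior point of the image of that orthant every term of ψ(Φ(y, 1)) is nonnegative and
    -- one is positive, a contradiction.
    let ε : ι → Bool := fun j => decide (0 ≤ ψ (Pi.single j 1))
    have ho := horth ε ⟨i, by simpa [ε] using hi.le⟩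
    obtain ⟨y, hy⟩ := (hf.isSolidBody _ ho).interior_nonempty
    have hmem : ∀ j, y ∈ interior (f (b.halfPart B (ε j) j)) := fun j =>
      interior_mono (hf.mono ho (hhalf _ j) (Set.iInter_subset _ j)) hy
    have h0 : ψ (Φ (y, 1)) = 0 := hψ ⟨_, rfl⟩
    rw [LinearMap.pi_apply_eq_sum_univ] at h0
    have hterm : ∀ j, 0 ≤ Φ (y, 1) j * ψ (Pi.single j 1) ∧
        (0 < ψ (Pi.single j 1) → 0 < Φ (y, 1) j * ψ (Pi.single j 1)) := by
      intro j
      have hj := hmem j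
      rw [hΦ]
      by_cases hs : 0 ≤ ψ (Pi.single j 1)
      · have : ε j = true := by simpa [ε] using hs
        rw [this] at hj
        have := sub_pos.mpr (hpos j y hj)
        exact ⟨mul_nonneg this.le hs, fun h => mul_pos this h⟩
      · have : ε j = false := by simpa [ε] using hs
        rw [this] at hj
        have := sub_neg.mpr (hneg j y hj)
        exact ⟨mul_nonneg_of_nonpos_of_nonpos this.le (not_le.mp hs).le,
          fun h => (hs h.le).elim⟩
    have : 0 < ∑ j, Φ (y, 1) j * ψ (Pi.single j 1) :=
      Finset.sum_pos' (fun j _ => (hterm j).1) ⟨i, Finset.mem_univ i, (hterm i).2 hi⟩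
    simp only [smul_eq_mul] at h0
    have hsingle : ∀ j : ι, (fun k => if j = k then (1 : ℝ) else 0) = Pi.single j 1 := by
      intro j
      ext k
      simp [Pi.single_apply, eq_comm]
    simp only [hsingle] at h0
    exact this.ne' h0
  have hsurj : Function.Surjective Φ := by
    rw [← LinearMap.range_eq_top]
    by_contra hne
    obtain ⟨ψ, hψ, hle⟩ := Submodule.exists_le_ker_of_lt_top _ (lt_top_iff_ne_top.mpr hne)
    apply hψ
    refine LinearMap.pi_ext' fun i => LinearMap.ext_ring ?_
    have h1 := key ψ hle i
    have h2 := key (-ψ) (hle.trans fun z hz => by simpa using hz) i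
    simp only [LinearMap.neg_apply] at h2
    simpa using le_antisymm h1 (by linarith)
  have hinj : Function.Injective Φ := by
    refine (LinearMap.injective_iff_surjective_of_finrank_eq_finrank ?_).mpr hsurj
    rw [Module.finrank_prod, Module.finrank_self, Module.finrank_fintype_fun_eq_card, hcard]
  have hbB : ∀ j, b j ∈ B := fun j => by simpa [B] using hbR j
  have hbt : ∀ i j, b j ∈ b.halfPart B true i := by
    refine fun i j => ⟨hbB j, ?_⟩
    by_cases h : i = j
    · subst h
      simp
    · simp [b.coord_apply_ne h]
  -- The vertex `b j` lies in both halves cut by the i-th facet, so its image point lies on both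
  -- sides of the separating hyperplane.
  have hzero : ∀ i j, i ≠ j → Φ (g (b j), 1) i = 0 := by
    intro i j hij
    rw [hΦ]
    refine le_antisymm (sub_nonpos.mpr (hnonpos i _ (hg _ (hhalf false i) _ ⟨hbB j, ?_⟩)))
      (sub_nonneg.mpr (hnonneg i _ (hg _ (hhalf true i) _ (hbt i j))))
    simp [b.coord_apply_ne hij]
  have hdiag : ∀ j, 0 < Φ (g (b j), 1) j := by
    intro j
    refine lt_of_le_of_ne ?_ fun h => ?_
    · rw [hΦ]
      exact sub_nonneg.mpr (hnonneg j _ (hg _ (hhalf true j) _ (hbt j j)))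
    · have : Φ (g (b j), 1) = Φ 0 := by
        ext i
        by_cases hij : i = j
        · subst hij
          rw [← h]
          simp
        · rw [hzero i j hij]
          simp
      have := congrArg Prod.snd (hinj this)
      simp at this
  intro y hy
  have hSsub : ∀ i, convexHull ℝ (Set.range b) ⊆ b.halfPart B true i := fun i =>
    convexHull_min (by rintro _ ⟨j, rfl⟩; exact hbt i j) (hhalf true i).convex
  have hynn : ∀ i, 0 ≤ Φ (y, 1) i := by
    intro i
    rw [hΦ]
    exact sub_nonneg.mpr (hnonneg i _ (hf.mono hS (hhalf true i) (hSsub i) hy))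
  let w : ι → ℝ := fun j => Φ (y, 1) j / Φ (g (b j), 1) j
  -- Φ is diagonal on the lifted image vertices; the last component says that the weights sum to 1.
  have hcomb : (y, (1 : ℝ)) = ∑ j, w j • (g (b j), (1 : ℝ)) := by
    apply hinj
    ext i
    rw [map_sum, Finset.sum_apply, Finset.sum_eq_single i]
    · rw [map_smul, Pi.smul_apply, smul_eq_mul, div_mul_cancel₀ _ (hdiag i).ne']
    · intro j _ hj
      rw [map_smul, Pi.smul_apply, hzero i j hj.symm, smul_zero]
    · simp
  have h1 : y = ∑ j, w j • g (b j) := by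
    simpa [Prod.fst_sum] using congrArg Prod.fst hcomb
  have h2 : 1 = ∑ j, w j := by
    simpa [Prod.snd_sum] using congrArg Prod.snd hcomb
  rw [h1]
  exact (convex_convexHull ℝ _).sum_mem (fun j _ => div_nonneg (hynn j) (hdiag j).le) h2.symm
    fun j _ => subset_convexHull ℝ _ ⟨j, rfl⟩

end PreservesInter

/-! ### From barycentric coordinates to an affinity -/

section Affine

variable {E : Type*} [NormedAddCommGroup E] [NormedSpace ℝ E] [FiniteDimensional ℝ E]

theorem exists_simplex_mem_mem (x y : E) :
    ∃ b : AffineBasis (Fin (Module.finrank ℝ E + 1)) ℝ E,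
      x ∈ convexHull ℝ (Set.range b) ∧ y ∈ convexHull ℝ (Set.range b) := by
  obtain ⟨b⟩ := AffineBasis.exists_affineBasis_of_finiteDimensional
    (ι := Fin (Module.finrank ℝ E + 1)) (k := ℝ) (P := E) (by simp)
  let c := Finset.univ.centroid ℝ b
  have hc : ∀ i, 0 < b.coord i c := by
    intro i
    rw [b.coord_apply_centroid (Finset.mem_univ i)]
    simp only [Finset.card_univ, Fintype.card_fin]
    positivity
  have hev : ∀ z : E, ∀ᶠ δ : ℝ in 𝓝[>] 0, ∀ i, 0 < b.coord i (c + δ • z) := by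
    intro z
    refine Filter.eventually_all.mpr fun i => ?_
    have h1 : Continuous fun δ : ℝ => b.coord i (c + δ • z) :=
      (b.coord i).continuous_of_finiteDimensional.comp (by fun_prop)
    exact (h1.continuousAt.eventually_const_lt (by simpa using hc i)).filter_mono
      nhdsWithin_le_nhds
  obtain ⟨δ, ⟨hx, hy⟩, hδ⟩ := (((hev x).and (hev y)).and self_mem_nhdsWithin).exists
  have hδ0 : δ ≠ 0 := ne_of_gt hδ
  -- The simplex is moved to have its centroid at 0 and enlarged by 1/δ, with δ so small that it
  -- swallows both points.
  refine ⟨(Units.mk0 δ hδ0)⁻¹ • (-c +ᵥ b), ?_⟩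
  have : ∀ z : E, (∀ i, 0 < b.coord i (c + δ • z)) →
      z ∈ convexHull ℝ (Set.range ((Units.mk0 δ hδ0)⁻¹ • (-c +ᵥ b))) := by
    intro z hz
    have h1 := (b.convexHull_eq_nonneg_coord).ge fun i => (hz i).le
    rw [AffineBasis.coe_smul, AffineBasis.coe_vadd]
    let T : E →ᵃ[ℝ] E := δ⁻¹ • (AffineMap.id ℝ E - AffineMap.const ℝ E c)
    have hT : ∀ w, T w = δ⁻¹ • (w - c) := fun w => by simp [T]
    have h2 : (Units.mk0 δ hδ0)⁻¹ • (-c +ᵥ ⇑b) = T ∘ b := by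
      ext i
      simp [hT, Units.smul_def, sub_eq_neg_add]
    rw [h2, Set.range_comp, ← T.image_convexHull]
    exact ⟨_, h1, by rw [hT]; simp [smul_smul, hδ0]⟩
  exact ⟨this x hx, this y hy⟩

/-- A map that preserves convex combinations of two points is affine. -/
theorem exists_affineMap_of_convex_combination {g : E → E}
    (h : ∀ x y : E, ∀ t : ℝ, 0 ≤ t → t ≤ 1 →
      g ((1 - t) • x + t • y) = (1 - t) • g x + t • g y) :
    ∃ A : E →ᵃ[ℝ] E, ⇑A = g := by
  let L : E → E := fun x => g x - g 0
  have h1 : ∀ (x : E) (t : ℝ), 0 ≤ t → t ≤ 1 → L (t • x) = t • L x := by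
    intro x t h0 h1
    have := h 0 x t h0 h1
    simp only [smul_zero, zero_add] at this
    simp only [L, this]
    module
  have h2 : ∀ (x : E) (t : ℝ), 0 ≤ t → L (t • x) = t • L x := by
    intro x t h0
    rcases le_total t 1 with ht | ht
    · exact h1 x t h0 ht
    · have hpos : 0 < t := by linarith
      have := h1 (t • x) t⁻¹ (by positivity) (inv_le_one_of_one_le₀ ht)
      rw [smul_smul, inv_mul_cancel₀ hpos.ne', one_smul] at this
      rw [this, smul_smul, mul_inv_cancel₀ hpos.ne', one_smul]
  have hadd : ∀ x y, L (x + y) = L x + L y := by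
    intro x y
    have h3 := h x y (1 / 2) (by norm_num) (by norm_num)
    have h4 : (1 - 1 / 2 : ℝ) • x + (1 / 2 : ℝ) • y = (1 / 2 : ℝ) • (x + y) := by module
    rw [h4] at h3
    have h5 := h1 (x + y) (1 / 2) (by norm_num) (by norm_num)
    have h6 : L ((1 / 2 : ℝ) • (x + y)) = (1 / 2 : ℝ) • (L x + L y) := by
      simp only [L, h3]
      module
    rw [h6] at h5
    exact (smul_right_injective E (by norm_num : (1 / 2 : ℝ) ≠ 0) h5).symm
  have hL0 : L 0 = 0 := by simp [L]
  have hneg : ∀ x, L (-x) = -L x := by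
    intro x
    have := hadd (-x) x
    rw [neg_add_cancel, hL0] at this
    exact eq_neg_of_add_eq_zero_left this.symm
  let l : E →ₗ[ℝ] E :=
    { toFun := L
      map_add' := hadd
      map_smul' := by
        intro t x
        rcases le_total 0 t with ht | ht
        · exact h2 x t ht
        · have := h2 x (-t) (by linarith)
          rw [neg_smul, hneg, neg_smul] at this
          exact neg_injective this }
  refine ⟨l.toAffineMap + AffineMap.const ℝ E (g 0), ?_⟩
  ext x
  simp [l, L]

end Affine

namespace PreservesInter

variable {E : Type*} [NormedAddCommGroup E] [NormedSpace ℝ E] [FiniteDimensional ℝ E]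
  [MeasurableSpace E] [BorelSpace E] {μ : Measure E} [μ.IsAddHaarMeasure] {f : Set E → Set E}
  {ι : Type*} [Fintype ι]

/-- Replacing a vertex by x multiplies the volume by a barycentric coordinate of x. Both the simplex
and its modification go to simplices of equal volume, so positive coordinates are preserved. -/
theorem map_barycentric [Nontrivial E] (hf : PreservesInter μ f) {g : E → E}
    (hg : ∀ K, IsSolidBody K → ∀ x ∈ K, g x ∈ f K) (b : AffineBasis ι ℝ E) {x : E}
    (hx : x ∈ convexHull ℝ (Set.range b)) : g x = ∑ i, b.coord i x • g (b i) := by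
  classical
  have hS := isSolidBody_simplex b
  have hcard := b.card_eq_finrank_add_one
  have hfS := hf.map_simplex hg b
  have hμ : μ (convexHull ℝ (Set.range (g ∘ b))) = μ (convexHull ℝ (Set.range b)) := by
    rw [← hfS, hf.measure_eq hS]
  obtain ⟨b', hb'⟩ := exists_affineBasis_of_measure_ne_zero hcard (g ∘ b)
    (hμ ▸ hS.measure_ne_zero : μ (convexHull ℝ (Set.range (g ∘ b))) ≠ 0)
  have hgx : g x ∈ convexHull ℝ (Set.range b') := by
    rw [hb', ← hfS]
    exact hg _ hS x hx
  rw [b.convexHull_eq_nonneg_coord] at hx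
  rw [b'.convexHull_eq_nonneg_coord] at hgx
  have hle : ∀ i, b.coord i x ≤ b'.coord i (g x) := by
    intro i
    rcases (hx i).eq_or_lt with h0 | h0
    · rw [← h0]
      exact hgx i
    have hup := measure_simplex_update (μ := μ) b i x
    have hne : μ (convexHull ℝ (Set.range (Function.update b i x))) ≠ 0 := by
      rw [hup]
      exact mul_ne_zero (by simpa using h0.ne') hS.measure_ne_zero
    obtain ⟨c, hc⟩ := exists_affineBasis_of_measure_ne_zero hcard _ hne
    have hcμ := hf.measure_eq (isSolidBody_simplex c)
    rw [hf.map_simplex hg c, hc, Function.comp_update, ← hb', measure_simplex_update, hup, hb', hμ,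
      ENNReal.mul_left_inj hS.measure_ne_zero hS.measure_ne_top,
      ENNReal.ofReal_eq_ofReal_iff (abs_nonneg _) (abs_nonneg _), abs_of_pos h0,
      abs_of_nonneg (hgx i)] at hcμ
    exact hcμ.ge
  -- A zero coordinate gives a degenerate simplex and only an inequality; equality follows since
  -- both families sum to 1.
  have heq := (Finset.sum_eq_sum_iff_of_le fun i (_ : i ∈ Finset.univ) => hle i).mp
    (by rw [b.sum_coord_apply_eq_one, b'.sum_coord_apply_eq_one])
  conv_lhs => rw [← b'.linear_combination_coord_eq_self (g x)]
  refine Finset.sum_congr rfl fun i hi => ?_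
  rw [heq i hi, hb']
  rfl

/-- A map of solid bodies that preserves the measure of intersections is induced by a
measure preserving affinity. -/
theorem exists_affineEquiv [Nontrivial E] (hf : PreservesInter μ f) :
    ∃ A : E ≃ᵃ[ℝ] E, |LinearMap.det (A.linear : E →ₗ[ℝ] E)| = 1 ∧
      ∀ K, IsSolidBody K → f K = A '' K := by
  obtain ⟨g, hg⟩ := hf.exists_selection
  obtain ⟨A, hA⟩ := exists_affineMap_of_convex_combination (g := g) (by
    intro x y t h0 h1
    obtain ⟨b, hx, hy⟩ := exists_simplex_mem_mem x y
    have hz := (convex_convexHull ℝ (Set.range b)) hx hy (sub_nonneg.mpr h1) h0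
      (sub_add_cancel 1 t)
    rw [hf.map_barycentric hg b hz, hf.map_barycentric hg b hx, hf.map_barycentric hg b hy,
      Finset.smul_sum, Finset.smul_sum, ← Finset.sum_add_distrib]
    refine Finset.sum_congr rfl fun i _ => ?_
    have : b.coord i ((1 - t) • x + t • y) = (1 - t) * b.coord i x + t * b.coord i y :=
      Convex.combo_affine_apply (sub_add_cancel 1 t)
    rw [this, add_smul, mul_smul, mul_smul])
  obtain ⟨b, -, -⟩ := exists_simplex_mem_mem (0 : E) 0
  have hS := isSolidBody_simplex b
  have hdet : |LinearMap.det A.linear| = 1 := by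
    have h1 := hf.measure_eq hS
    rw [hf.map_simplex hg b, Set.range_comp, ← hA, ← A.image_convexHull,
      measure_image_affineMap] at h1
    have h2 : ENNReal.ofReal |LinearMap.det A.linear| = 1 := by
      rwa [← ENNReal.mul_left_inj (hS.measure_ne_zero (μ := μ)) hS.measure_ne_top, one_mul]
    simpa using h2
  have hne : LinearMap.det A.linear ≠ 0 := by
    intro h
    simp [h] at hdet
  refine ⟨AffineEquiv.ofBijective
    (A.linear_bijective_iff.mp (A.linear.equivOfDetNeZero hne).bijective), hdet, fun K hK => ?_⟩
  change f K = A '' K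
  refine ((hf.isSolidBody K hK).eq_of_subset_of_measure_le (μ := μ) ?_ ?_ ?_).symm
  · exact (hK.isCompact.image A.continuous_of_finiteDimensional).isClosed
  · rintro _ ⟨x, hx, rfl⟩
    rw [hA]
    exact hg K hK x hx
  · rw [measure_image_affineMap, hdet, hf.measure_eq hK]
    simp

end PreservesInter

/-! ### Sublevel sets of coercive convex functions -/

/-- The sublevel set of an extended real valued function at a real level. -/
def sublevel {E : Type*} (u : E → EReal) (t : ℝ) : Set E := {x | u x ≤ t}

theorem mem_sublevel {E : Type*} {u : E → EReal} {t : ℝ} {x : E} :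
    x ∈ sublevel u t ↔ u x ≤ t := Iff.rfl

theorem sublevel_mono {E : Type*} (u : E → EReal) {s t : ℝ} (h : s ≤ t) :
    sublevel u s ⊆ sublevel u t :=
  fun _ hx => le_trans (mem_sublevel.mp hx) (EReal.coe_le_coe_iff.mpr h)

namespace IsCoerciveConvexFullDim

variable {n : ℕ} {u : EuclideanSpace ℝ (Fin n) → EReal}

theorem combination_le (hu : IsCoerciveConvexFullDim n u) {x y : EuclideanSpace ℝ (Fin n)}
    {s t a b : ℝ} (hx : u x ≤ s) (hy : u y ≤ t) (ha : 0 < a) (hb : 0 < b) (hab : a + b = 1) :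
    u (a • x + b • y) ≤ ((a * s + b * t : ℝ) : EReal) := by
  refine (hu.convex x y a b ha hb hab).trans ?_
  rw [EReal.coe_add, EReal.coe_mul, EReal.coe_mul]
  exact add_le_add (mul_le_mul_of_nonneg_left hx (by exact_mod_cast ha.le))
    (mul_le_mul_of_nonneg_left hy (by exact_mod_cast hb.le))

theorem isClosed_sublevel (hu : IsCoerciveConvexFullDim n u) (t : ℝ) :
    IsClosed (sublevel u t) :=
  hu.lsc.isClosed_preimage t

theorem isCompact_sublevel (hu : IsCoerciveConvexFullDim n u) (t : ℝ) :
    IsCompact (sublevel u t) := by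
  have h := hu.coercive.eventually (lt_mem_nhds (EReal.coe_lt_top t))
  obtain ⟨K, hK, hsub⟩ := mem_cocompact.mp h
  refine hK.of_isClosed_subset (hu.isClosed_sublevel t) fun x hx => ?_
  by_contra hxK
  have h1 : (t : EReal) < u x := hsub hxK
  exact h1.not_ge hx

theorem convex_sublevel (hu : IsCoerciveConvexFullDim n u) (t : ℝ) :
    Convex ℝ (sublevel u t) := by
  rw [convex_iff_forall_pos]
  intro x hx y hy a b ha hb hab
  have := hu.combination_le hx hy ha hb hab
  rwa [← add_mul, hab, one_mul] at this

theorem exists_sublevel_eq_empty (hu : IsCoerciveConvexFullDim n u) :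
    ∃ c, sublevel u c = ∅ := by
  by_contra! h
  obtain ⟨x, hx⟩ := IsCompact.nonempty_iInter_of_sequence_nonempty_isCompact_isClosed
    (fun k : ℕ => sublevel u (-k))
    (fun k => sublevel_mono u (by push_cast; linarith)) (fun k => h _)
    (hu.isCompact_sublevel _) (fun k => hu.isClosed_sublevel _)
  rw [Set.mem_iInter] at hx
  have hx0 := hu.ne_bot x
  have hx1 : u x ≠ ⊤ := ne_top_of_le_ne_top (EReal.coe_ne_top _) (mem_sublevel.mp (hx 0))
  lift u x to ℝ using ⟨hx1, hx0⟩ with r hr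
  obtain ⟨k, hk⟩ := exists_nat_gt (-r)
  have := mem_sublevel.mp (hx k)
  rw [← hr, EReal.coe_le_coe_iff] at this
  linarith

theorem exists_coe_eq (hu : IsCoerciveConvexFullDim n u) : ∃ x, ∃ r : ℝ, u x = r := by
  obtain ⟨x, hx⟩ := hu.proper
  exact ⟨x, (u x).toReal, (EReal.coe_toReal hx (hu.ne_bot x)).symm⟩

/-- The full-dimensional convex domain has nonempty interior, hence positive measure, and is a
countable union of sublevel sets, so one of these has positive measure. -/
theorem exists_sublevel_isSolidBody (hu : IsCoerciveConvexFullDim n u) :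
    ∃ k : ℕ, IsSolidBody (sublevel u k) := by
  have hdom : {x | u x < ⊤} = ⋃ k : ℕ, sublevel u k := by
    ext x
    simp only [Set.mem_ofPred_eq, Set.mem_iUnion, mem_sublevel]
    constructor
    · intro h
      lift u x to ℝ using ⟨h.ne, hu.ne_bot x⟩ with r
      obtain ⟨k, hk⟩ := exists_nat_ge r
      exact ⟨k, by exact_mod_cast hk⟩
    · rintro ⟨k, hk⟩
      exact hk.trans_lt (EReal.coe_lt_top _)
  have hmono : Monotone fun k : ℕ => sublevel u k :=
    fun i j hij => sublevel_mono u (by exact_mod_cast hij)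
  have hconv : Convex ℝ {x | u x < ⊤} := by
    rw [hdom]
    exact hmono.directed_le.convex_iUnion fun k => hu.convex_sublevel _
  have hne : {x | u x < ⊤}.Nonempty := by
    obtain ⟨x, hx⟩ := hu.proper
    exact ⟨x, lt_top_iff_ne_top.mpr hx⟩
  have hint : (interior {x | u x < ⊤}).Nonempty := by
    rw [hconv.interior_nonempty_iff_affineSpan_eq_top,
      AffineSubspace.affineSpan_eq_top_iff_vectorSpan_eq_top_of_nonempty ℝ _ _ hne]
    exact Submodule.eq_top_of_finrank_eq (by rw [hu.full_dim, finrank_euclideanSpace_fin])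
  have hpos := Measure.measure_pos_of_nonempty_interior volume hint
  rw [hdom] at hpos
  obtain ⟨k, hk⟩ := exists_measure_pos_of_not_measure_iUnion_null hpos.ne'
  exact ⟨k, isSolidBody_of_measure_ne_zero (hu.convex_sublevel _) (hu.isCompact_sublevel _) hk.ne'⟩

/-- Shrinking some solid sublevel set strongly towards a point of level `s` keeps the values below
`t`, by convexity. Only the minimal level can fail to be solid. -/
theorem isSolidBody_sublevel (hu : IsCoerciveConvexFullDim n u) {s t : ℝ}
    (hs : (sublevel u s).Nonempty) (hst : s < t) : IsSolidBody (sublevel u t) := by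
  obtain ⟨z, hz⟩ := hs
  obtain ⟨k, hk⟩ := hu.exists_sublevel_isSolidBody
  have hev : ∀ᶠ a : ℝ in 𝓝[>] 0, (1 - a) * s + a * k < t ∧ a < 1 := by
    have h1 : Continuous fun a : ℝ => (1 - a) * s + a * k := by fun_prop
    exact ((h1.continuousAt.eventually_lt_const (by simpa using hst)).and
      (eventually_lt_nhds one_pos)).filter_mono nhdsWithin_le_nhds
  obtain ⟨a, ⟨ha, ha1⟩, ha0⟩ := (hev.and self_mem_nhdsWithin).exists
  have ha0 : 0 < a := ha0
  refine ⟨hu.convex_sublevel t, hu.isCompact_sublevel t, ?_⟩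
  let e := AffineEquiv.homothetyUnitsMulHom z (Units.mk0 a ha0.ne')
  have hsub : e '' sublevel u k ⊆ sublevel u t := by
    rintro _ ⟨y, hy, rfl⟩
    have h := hu.combination_le hz hy (sub_pos.mpr ha1) ha0 (sub_add_cancel 1 a)
    have he : e y = (1 - a) • z + a • y := by
      simp only [e]
      rw [AffineEquiv.coe_homothetyUnitsMulHom_apply]
      simp only [AffineMap.homothety_apply, Units.val_mk0, vsub_eq_sub, vadd_eq_add]
      module
    rw [he]
    exact h.trans (EReal.coe_le_coe_iff.mpr ha.le)
  exact (hk.image_affineEquiv e).interior_nonempty.mono (interior_mono hsub)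

/-- Coercivity and convexity give linear growth, which is what makes exp(-u) integrable. -/
theorem exists_linear_le (hu : IsCoerciveConvexFullDim n u) :
    ∃ (x₀ : EuclideanSpace ℝ (Fin n)) (c R : ℝ), 0 < R ∧
      ∀ x, ((c + ‖x - x₀‖ / R : ℝ) : EReal) ≤ u x := by
  obtain ⟨x₀, r, hr⟩ := hu.exists_coe_eq
  obtain ⟨m, hm⟩ := hu.exists_sublevel_eq_empty
  obtain ⟨R, hR0, hR⟩ := (hu.isCompact_sublevel (r + 1)).isBounded.subset_ball_lt 0 x₀
  refine ⟨x₀, min r (m - 1), R, hR0, fun x => ?_⟩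
  by_cases hd : ‖x - x₀‖ ≤ R
  · have h1 : (m : EReal) ≤ u x := by
      by_contra! h
      exact Set.notMem_empty x (hm ▸ h.le : x ∈ (∅ : Set _))
    refine le_trans (EReal.coe_le_coe_iff.mpr ?_) h1
    have := (div_le_one hR0).mpr hd
    linarith [min_le_right r (m - 1)]
  · push Not at hd
    set d := ‖x - x₀‖
    have hd0 : 0 < d := hR0.trans hd
    by_contra! h
    have hx : u x ≤ ((r + d / R : ℝ) : EReal) :=
      h.le.trans (EReal.coe_le_coe_iff.mpr (by linarith [min_le_left r (m - 1)]))
    have hs1 : R / d < 1 := (div_lt_one hd0).mpr hd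
    have hs0 : 0 < R / d := by positivity
    -- The point of the segment at distance exactly R from x₀ would have value at most r + 1, but
    -- that sublevel set lies in the open ball.
    have hy := hu.combination_le hr.le hx (sub_pos.mpr hs1) hs0 (sub_add_cancel 1 _)
    have he : (1 - R / d) * r + R / d * (r + d / R) = r + 1 := by
      field_simp
      ring
    rw [he] at hy
    have hb := hR hy
    have hsub : (1 - R / d) • x₀ + (R / d) • x - x₀ = (R / d) • (x - x₀) := by module
    rw [Metric.mem_ball, dist_eq_norm, hsub, norm_smul, Real.norm_of_nonneg hs0.le,
      div_mul_cancel₀ _ hd0.ne'] at hb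
    exact lt_irrefl _ hb

end IsCoerciveConvexFullDim

/-! ### Functions constant on a body -/

open Classical in
/-- The function which is `c` on `K` and `+∞` elsewhere. -/
noncomputable def constOn {E : Type*} (K : Set E) (c : ℝ) (x : E) : EReal :=
  if x ∈ K then (c : EReal) else ⊤

theorem sublevel_constOn {E : Type*} (K : Set E) {c t : ℝ} (h : c ≤ t) :
    sublevel (constOn K c) t = K := by
  ext x
  by_cases hx : x ∈ K <;> simp [mem_sublevel, constOn, hx, h]

theorem sublevel_constOn_of_lt {E : Type*} (K : Set E) {c t : ℝ} (h : t < c) :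
    sublevel (constOn K c) t = ∅ := by
  ext x
  by_cases hx : x ∈ K <;> simp [mem_sublevel, constOn, hx, h]

theorem isCoerciveConvexFullDim_constOn {n : ℕ} {K : Set (EuclideanSpace ℝ (Fin n))}
    (hK : IsSolidBody K) (c : ℝ) : IsCoerciveConvexFullDim n (constOn K c) where
  ne_bot x := by by_cases hx : x ∈ K <;> simp [constOn, hx]
  proper := by
    obtain ⟨x, hx⟩ := hK.interior_nonempty
    exact ⟨x, by simp [constOn, interior_subset hx]⟩
  lsc := by
    rw [lowerSemicontinuous_iff_isClosed_preimage]
    intro y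
    by_cases hy : y = ⊤
    · simp [hy]
    · by_cases hc : (c : EReal) ≤ y
      · have : constOn K c ⁻¹' Set.Iic y = K := by
          ext x
          by_cases hx : x ∈ K <;> simp [constOn, hx, hc, hy]
        rw [this]
        exact hK.isCompact.isClosed
      · have : constOn K c ⁻¹' Set.Iic y = ∅ := by
          ext x
          by_cases hx : x ∈ K <;> simp [constOn, hx, hy, not_le.mp hc]
        rw [this]
        exact isClosed_empty
  coercive := by
    refine tendsto_const_nhds.congr' ?_
    filter_upwards [hK.isCompact.compl_mem_cocompact] with x hx
    simp only [Set.mem_compl_iff] at hx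
    simp [constOn, hx]
  convex := by
    intro x y a b ha hb hab
    have ha' : (0 : EReal) < a := by exact_mod_cast ha
    have hb' : (0 : EReal) < b := by exact_mod_cast hb
    by_cases hx : x ∈ K
    · by_cases hy : y ∈ K
      · have := hK.convex hx hy ha.le hb.le hab
        simp only [constOn, this, hx, hy, if_true]
        norm_cast
        rw [← add_mul, hab, one_mul]
      · simp only [constOn, hx, hy, if_true, if_false]
        rw [EReal.mul_top_of_pos hb', ← EReal.coe_mul, EReal.coe_add_top]
        exact le_top
    · simp only [constOn, hx, if_false]
      rw [EReal.mul_top_of_pos ha', EReal.top_add_of_ne_bot]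
      · exact le_top
      · by_cases hy : y ∈ K
        · simp only [hy, if_true]
          rw [← EReal.coe_mul]
          exact EReal.coe_ne_bot _
        · simp only [hy, if_false]
          rw [EReal.mul_top_of_pos hb']
          exact top_ne_bot
  full_dim := by
    have hdom : {x | constOn K c x < ⊤} = K := by
      ext x
      by_cases hx : x ∈ K <;> simp [constOn, hx]
    have hne : K.Nonempty := hK.interior_nonempty.mono interior_subset
    have h := hK.convex.interior_nonempty_iff_affineSpan_eq_top.mp hK.interior_nonempty
    rw [hdom, (AffineSubspace.affineSpan_eq_top_iff_vectorSpan_eq_top_of_nonempty ℝ _ _ hne).mp h,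
      finrank_top, finrank_euclideanSpace_fin]

/-- The element of the function space which is `c` on `K` and `+∞` elsewhere. -/
noncomputable def constOnBody {n : ℕ} {K : Set (EuclideanSpace ℝ (Fin n))} (hK : IsSolidBody K)
    (c : ℝ) : CoerciveConvexFullDim n :=
  ⟨constOn K c, isCoerciveConvexFullDim_constOn hK c⟩

/-! ### The distances and their limits along ramps -/

section ZetaEval

theorem zetaEval_top (ζ : ℝ → ℝ) : zetaEval ζ ⊤ = 0 := by simp [zetaEval]

theorem zetaEval_coe (ζ : ℝ → ℝ) (t : ℝ) : zetaEval ζ t = ζ t := by simp [zetaEval]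

theorem zetaEval_add (ζ ξ : ℝ → ℝ) (t : EReal) :
    zetaEval (fun s => ζ s + ξ s) t = zetaEval ζ t + zetaEval ξ t := by
  by_cases h : t = ⊤ <;> simp [zetaEval, h]

theorem zetaEval_anti {ζ : ℝ → ℝ} (h0 : ∀ t, 0 ≤ ζ t) (ha : Antitone ζ) {s t : EReal}
    (hs : s ≠ ⊥) (h : s ≤ t) : zetaEval ζ t ≤ zetaEval ζ s := by
  by_cases ht : t = ⊤
  · rw [ht, zetaEval_top]
    by_cases hs' : s = ⊤
    · rw [hs', zetaEval_top]
    · rw [zetaEval, if_neg hs']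
      exact h0 _
  · have hs' : s ≠ ⊤ := ne_top_of_le_ne_top ht h
    rw [zetaEval, zetaEval, if_neg hs', if_neg ht]
    exact ha (EReal.toReal_le_toReal h hs ht)

theorem measurable_zetaEval {ζ : ℝ → ℝ} (h : Continuous ζ) : Measurable (zetaEval ζ) :=
  Measurable.ite (measurableSet_singleton ⊤) measurable_const
    (h.measurable.comp measurable_ereal_toReal)

theorem enorm_add_of_mul_nonneg {a b : ℝ} (h : 0 ≤ a * b) : ‖a + b‖ₑ = ‖a‖ₑ + ‖b‖ₑ := by
  rw [Real.enorm_eq_ofReal_abs, Real.enorm_eq_ofReal_abs, Real.enorm_eq_ofReal_abs,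
    ← ENNReal.ofReal_add (abs_nonneg _) (abs_nonneg _), (abs_add_eq_add_abs_iff a b).mpr]
  rcases mul_nonneg_iff.mp h with h | h
  · exact Or.inl h
  · exact Or.inr h

end ZetaEval

section Delta

variable {n : ℕ}

theorem deltaZeta_eq_lintegral (ζ : ℝ → ℝ) (u v : CoerciveConvexFullDim n) :
    deltaZeta ζ u v = ∫⁻ x, ‖zetaEval ζ (u.1 x) - zetaEval ζ (v.1 x)‖ₑ :=
  eLpNorm_one_eq_lintegral_enorm

theorem measurable_zetaEval_comp {ζ : ℝ → ℝ} (h : Continuous ζ) (u : CoerciveConvexFullDim n) :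
    Measurable fun x => zetaEval ζ (u.1 x) :=
  (measurable_zetaEval h).comp u.2.lsc.measurable

/-- At each point the two differences have the same sign, as both profiles decrease, so absolute
values add. -/
theorem deltaZeta_add {ζ ξ : ℝ → ℝ} (hζc : Continuous ζ) (hζ0 : ∀ t, 0 ≤ ζ t) (hζ : Antitone ζ)
    (hξ0 : ∀ t, 0 ≤ ξ t) (hξ : Antitone ξ) (u v : CoerciveConvexFullDim n) :
    deltaZeta (fun s => ζ s + ξ s) u v = deltaZeta ζ u v + deltaZeta ξ u v := by
  simp only [deltaZeta_eq_lintegral]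
  have hm : Measurable fun x => ‖zetaEval ζ (u.1 x) - zetaEval ζ (v.1 x)‖ₑ :=
    ((measurable_zetaEval_comp hζc u).sub (measurable_zetaEval_comp hζc v)).enorm
  rw [← lintegral_add_left hm]
  refine lintegral_congr fun x => ?_
  rw [zetaEval_add, zetaEval_add, add_sub_add_comm]
  apply enorm_add_of_mul_nonneg
  rcases le_total (u.1 x) (v.1 x) with h | h
  · exact mul_nonneg (sub_nonneg.mpr (zetaEval_anti hζ0 hζ (u.2.ne_bot x) h))
      (sub_nonneg.mpr (zetaEval_anti hξ0 hξ (u.2.ne_bot x) h))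
  · exact mul_nonneg_of_nonpos_of_nonpos
      (sub_nonpos.mpr (zetaEval_anti hζ0 hζ (v.2.ne_bot x) h))
      (sub_nonpos.mpr (zetaEval_anti hξ0 hξ (v.2.ne_bot x) h))

theorem integrable_exp_neg_norm_div {R : ℝ} (hR : 0 < R) :
    Integrable fun x : EuclideanSpace ℝ (Fin n) => Real.exp (-(‖x‖ / R)) := by
  have h1 : Integrable fun x : EuclideanSpace ℝ (Fin n) => (1 + ‖x‖) ^ (-((n : ℝ) + 1)) :=
    integrable_one_add_norm (by rw [finrank_euclideanSpace_fin]; linarith)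
  refine (h1.const_mul (Real.exp (1 / R) * ((n + 1).factorial * R ^ (n + 1)))).mono'
    (by fun_prop) (Filter.Eventually.of_forall fun x => ?_)
  have hx : 0 < 1 + ‖x‖ := by positivity
  -- The power n + 1 exceeds the dimension, so its reciprocal is integrable; exp(1/R) compensates
  -- the shift from ‖x‖ to 1 + ‖x‖.
  have h2 := Real.pow_div_factorial_le_exp ((1 + ‖x‖) / R) (by positivity) (n + 1)
  have h3 : (1 + ‖x‖) ^ (-((n : ℝ) + 1)) = ((1 + ‖x‖) ^ (n + 1))⁻¹ := by
    rw [Real.rpow_neg hx.le]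
    congr 1
    exact_mod_cast Real.rpow_natCast (1 + ‖x‖) (n + 1)
  have h4 : Real.exp (-(‖x‖ / R)) = Real.exp (1 / R) * (Real.exp ((1 + ‖x‖) / R))⁻¹ := by
    rw [← Real.exp_neg, ← Real.exp_add]
    congr 1
    ring
  rw [Real.norm_of_nonneg (Real.exp_pos _).le, h3, h4, mul_assoc]
  refine mul_le_mul_of_nonneg_left ?_ (Real.exp_pos _).le
  rw [inv_le_comm₀ (Real.exp_pos _) (by positivity)]
  refine le_trans (le_of_eq ?_) h2
  rw [div_pow]
  field_simp

theorem integrable_zetaEval_exp (u : CoerciveConvexFullDim n) :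
    Integrable fun x => zetaEval (fun s => Real.exp (-s)) (u.1 x) := by
  obtain ⟨x₀, c, R, hR, h⟩ := u.2.exists_linear_le
  refine (((integrable_exp_neg_norm_div hR).comp_sub_right x₀).const_mul (Real.exp (-c))).mono'
    (measurable_zetaEval_comp (by fun_prop) u).aestronglyMeasurable
    (Filter.Eventually.of_forall fun x => ?_)
  have h0 : ∀ t : ℝ, 0 ≤ Real.exp (-t) := fun t => (Real.exp_pos _).le
  have hanti : Antitone fun s => Real.exp (-s) :=
    fun s t hst => Real.exp_le_exp.mpr (neg_le_neg hst)
  have h1 := zetaEval_anti h0 hanti (EReal.coe_ne_bot _) (h x)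
  have h2 := zetaEval_anti h0 hanti (u.2.ne_bot x) le_top
  rw [zetaEval_top] at h2
  rw [zetaEval_coe] at h1
  rw [Real.norm_of_nonneg h2, ← Real.exp_add]
  refine h1.trans (le_of_eq ?_)
  congr 1
  ring

theorem deltaZeta_exp_ne_top (u v : CoerciveConvexFullDim n) :
    deltaZeta (fun s => Real.exp (-s)) u v ≠ ⊤ := by
  rw [deltaZeta_eq_lintegral]
  exact ((integrable_zetaEval_exp u).sub (integrable_zetaEval_exp v)).hasFiniteIntegral.ne

/-- A continuous decreasing function which is `1` up to `t` and `0` from `t + 1 / (k + 1)` on. -/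
noncomputable def ramp (t : ℝ) (k : ℕ) (s : ℝ) : ℝ := max 0 (min 1 (1 - (k + 1) * (s - t)))

theorem continuous_ramp (t : ℝ) (k : ℕ) : Continuous (ramp t k) := by
  unfold ramp
  fun_prop

theorem ramp_nonneg (t : ℝ) (k : ℕ) (s : ℝ) : 0 ≤ ramp t k s := le_max_left _ _

theorem ramp_le_one (t : ℝ) (k : ℕ) (s : ℝ) : ramp t k s ≤ 1 :=
  max_le zero_le_one (min_le_left _ _)

theorem antitone_ramp (t : ℝ) (k : ℕ) : Antitone (ramp t k) := by
  intro a b hab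
  have h : (k + 1 : ℝ) * (a - t) ≤ (k + 1) * (b - t) :=
    mul_le_mul_of_nonneg_left (by linarith) (by positivity)
  exact max_le_max le_rfl (min_le_min le_rfl (by linarith))

theorem ramp_of_le {t s : ℝ} (k : ℕ) (h : s ≤ t) : ramp t k s = 1 := by
  have h1 : (k + 1 : ℝ) * (s - t) ≤ 0 :=
    mul_nonpos_of_nonneg_of_nonpos (by positivity) (by linarith)
  rw [ramp, min_eq_left (by linarith), max_eq_right zero_le_one]

theorem ramp_eq_zero {t s : ℝ} {k : ℕ} (h : 1 ≤ (k + 1) * (s - t)) : ramp t k s = 0 :=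
  max_eq_left ((min_le_right _ _).trans (by linarith))

theorem ramp_eq_zero_of_add_one_le {t s : ℝ} (k : ℕ) (h : t + 1 ≤ s) : ramp t k s = 0 := by
  apply ramp_eq_zero
  have : (0 : ℝ) ≤ k := k.cast_nonneg
  nlinarith

theorem isMomentClass_exp (hn : 1 ≤ n) : IsMomentClass n fun s => Real.exp (-s) where
  pos s := Real.exp_pos _
  continuous := by fun_prop
  strictAnti := fun a b hab => Real.exp_lt_exp.mpr (neg_lt_neg hab)
  finite_moment := by
    refine (Real.GammaIntegral_convergent (s := n) (by exact_mod_cast hn)).congr_fun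
      (fun s hs => ?_) measurableSet_Ioi
    simp only
    rw [← Real.rpow_natCast, Nat.cast_sub hn, Nat.cast_one]

/-- A ramp is neither positive nor strictly decreasing; the exponential repairs both. Vanishing from
t + 1 on, the ramp is at most exp(t + 1) exp(-s). -/
theorem isMomentClass_exp_add_ramp (hn : 1 ≤ n) (t : ℝ) (k : ℕ) :
    IsMomentClass n fun s => Real.exp (-s) + ramp t k s where
  pos s := add_pos_of_pos_of_nonneg (Real.exp_pos _) (ramp_nonneg t k s)
  continuous := (isMomentClass_exp hn).continuous.add (continuous_ramp t k)
  strictAnti := (isMomentClass_exp hn).strictAnti.add_antitone (antitone_ramp t k)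
  finite_moment := by
    have h1 := (isMomentClass_exp hn).finite_moment.const_mul (1 + Real.exp (t + 1))
    have hc : Continuous fun s : ℝ => (Real.exp (-s) + ramp t k s) * s ^ (n - 1) :=
      ((isMomentClass_exp hn).continuous.add (continuous_ramp t k)).mul (by fun_prop)
    refine h1.mono' hc.aestronglyMeasurable ?_
    filter_upwards [ae_restrict_mem measurableSet_Ioi] with s hs
    have hs : 0 < s := hs
    have hr : ramp t k s ≤ Real.exp (t + 1) * Real.exp (-s) := by
      rw [← Real.exp_add]
      rcases le_total (t + 1) s with h | h
      · rw [ramp_eq_zero_of_add_one_le k h]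
        exact (Real.exp_pos _).le
      · exact (ramp_le_one t k s).trans (Real.one_le_exp (by linarith))
    rw [Real.norm_of_nonneg (mul_nonneg
      (add_nonneg (Real.exp_pos _).le (ramp_nonneg t k s)) (by positivity)), ← mul_assoc]
    refine mul_le_mul_of_nonneg_right ?_ (by positivity)
    linarith

theorem deltaZeta_ramp_eq (hn : 1 ≤ n) {I : CoerciveConvexFullDim n → CoerciveConvexFullDim n}
    (hI : ∀ ζ : ℝ → ℝ, IsMomentClass n ζ → IsDeltaIsometry ζ I) (t : ℝ) (k : ℕ)
    (u v : CoerciveConvexFullDim n) :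
    deltaZeta (ramp t k) (I u) (I v) = deltaZeta (ramp t k) u v := by
  have hadd := fun u v : CoerciveConvexFullDim n => deltaZeta_add (ζ := fun s => Real.exp (-s))
    (ξ := ramp t k) (by fun_prop) (fun _ => (Real.exp_pos _).le)
    (isMomentClass_exp hn).strictAnti.antitone (ramp_nonneg t k)
    (antitone_ramp t k) u v
  have h1 := hI _ (isMomentClass_exp_add_ramp hn t k) u v
  rw [hadd, hadd, hI _ (isMomentClass_exp hn) u v] at h1
  exact (ENNReal.add_right_inj (deltaZeta_exp_ne_top u v)).mp h1

theorem tendsto_zetaEval_ramp (t : ℝ) {a : EReal} (ha : a ≠ ⊥) :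
    Tendsto (fun k => zetaEval (ramp t k) a) atTop (𝓝 (Set.indicator (Set.Iic (t : EReal)) 1 a)) := by
  by_cases h : a = ⊤
  · simp [h, zetaEval_top]
  lift a to ℝ using ⟨h, ha⟩
  simp only [zetaEval_coe]
  by_cases hat : a ≤ t
  · simp [ramp_of_le _ hat, Set.indicator, hat]
  · have : Set.indicator (Set.Iic (t : EReal)) (1 : EReal → ℝ) a = 0 := by
      simp [Set.indicator, hat]
    rw [this]
    push Not at hat
    obtain ⟨N, hN⟩ := exists_nat_ge (1 / (a - t))
    refine tendsto_const_nhds.congr' ?_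
    filter_upwards [eventually_ge_atTop N] with k hk
    rw [ramp_eq_zero]
    have h1 : (N : ℝ) ≤ k := by exact_mod_cast hk
    rw [div_le_iff₀ (by linarith)] at hN
    nlinarith

theorem tendsto_deltaZeta_ramp (t : ℝ) (u v : CoerciveConvexFullDim n) :
    Tendsto (fun k => deltaZeta (ramp t k) u v) atTop
      (𝓝 (volume (symmDiff (sublevel u.1 t) (sublevel v.1 t)))) := by
  have hmeas : ∀ (u : CoerciveConvexFullDim n) s, MeasurableSet (sublevel u.1 s) :=
    fun u s => (u.2.isClosed_sublevel s).measurableSet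
  simp only [deltaZeta_eq_lintegral]
  rw [← lintegral_indicator_one ((hmeas u t).symmDiff (hmeas v t))]
  refine tendsto_lintegral_of_dominated_convergence
    (Set.indicator (sublevel u.1 (t + 1) ∪ sublevel v.1 (t + 1)) 1)
    (fun k => ((measurable_zetaEval_comp (continuous_ramp t k) u).sub
      (measurable_zetaEval_comp (continuous_ramp t k) v)).enorm) ?_ ?_ ?_
  · refine fun k => Filter.Eventually.of_forall fun x => ?_
    have hz : ∀ w : CoerciveConvexFullDim n, x ∉ sublevel w.1 (t + 1) →
        zetaEval (ramp t k) (w.1 x) = 0 := by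
      intro w hw
      have hw' : ((t + 1 : ℝ) : EReal) ≤ w.1 x := (not_le.mp hw).le
      have h1 := zetaEval_anti (ramp_nonneg t k) (antitone_ramp t k) (EReal.coe_ne_bot _) hw'
      have h2 := zetaEval_anti (ramp_nonneg t k) (antitone_ramp t k) (w.2.ne_bot x) le_top
      rw [zetaEval_coe, ramp_eq_zero_of_add_one_le k le_rfl] at h1
      rw [zetaEval_top] at h2
      exact le_antisymm h1 h2
    have hb : ∀ w : CoerciveConvexFullDim n, 0 ≤ zetaEval (ramp t k) (w.1 x) ∧
        zetaEval (ramp t k) (w.1 x) ≤ 1 := by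
      intro w
      unfold zetaEval
      split_ifs
      · simp
      · exact ⟨ramp_nonneg _ _ _, ramp_le_one _ _ _⟩
    change ‖zetaEval (ramp t k) (u.1 x) - zetaEval (ramp t k) (v.1 x)‖ₑ ≤ _
    by_cases hx : x ∈ sublevel u.1 (t + 1) ∪ sublevel v.1 (t + 1)
    · rw [Set.indicator_of_mem hx, Pi.one_apply, Real.enorm_eq_ofReal_abs]
      rw [ENNReal.ofReal_le_one, abs_le]
      constructor <;> linarith [(hb u).1, (hb u).2, (hb v).1, (hb v).2]
    · rw [Set.mem_union, not_or] at hx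
      rw [hz u hx.1, hz v hx.2]
      simp
  · rw [lintegral_indicator_one ((hmeas u _).union (hmeas v _))]
    exact ((u.2.isCompact_sublevel _).union (v.2.isCompact_sublevel _)).measure_lt_top.ne
  · refine Filter.Eventually.of_forall fun x => ?_
    have h := ((tendsto_zetaEval_ramp t (u.2.ne_bot x)).sub
      (tendsto_zetaEval_ramp t (v.2.ne_bot x))).enorm
    convert h using 2
    by_cases hu : u.1 x ≤ t <;> by_cases hv : v.1 x ≤ t <;>
      simp [Set.indicator, Set.mem_symmDiff, mem_sublevel, hu, hv]

/-- Maps that are isometries for all `ζ` preserve the symmetric difference distance of sublevel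
sets. -/
theorem volume_symmDiff_sublevel (hn : 1 ≤ n)
    {I : CoerciveConvexFullDim n → CoerciveConvexFullDim n}
    (hI : ∀ ζ : ℝ → ℝ, IsMomentClass n ζ → IsDeltaIsometry ζ I) (u v : CoerciveConvexFullDim n)
    (t : ℝ) :
    volume (symmDiff (sublevel (I u).1 t) (sublevel (I v).1 t)) =
      volume (symmDiff (sublevel u.1 t) (sublevel v.1 t)) := by
  refine tendsto_nhds_unique (tendsto_deltaZeta_ramp t (I u) (I v)) ?_
  simp only [deltaZeta_ramp_eq hn hI]
  exact tendsto_deltaZeta_ramp t u v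

end Delta

/-! ### The affinity acting on each level -/

section MeasureSets

variable {α : Type*} [MeasurableSpace α] {μ : Measure α}

theorem measure_symmDiff_add_inter {s t : Set α} (hs : MeasurableSet s) (ht : MeasurableSet t) :
    μ (symmDiff s t) + (μ (s ∩ t) + μ (s ∩ t)) = μ s + μ t := by
  rw [measure_symmDiff_eq hs.nullMeasurableSet ht.nullMeasurableSet,
    ← measure_inter_add_sdiff s ht, ← measure_inter_add_sdiff t hs, Set.inter_comm t s]
  ring

theorem ENNReal.eq_of_add_self_eq {a b : ENNReal} (h : a + a = b + b) : a = b := by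
  rw [← two_mul, ← two_mul] at h
  exact (ENNReal.mul_right_inj two_ne_zero ENNReal.ofNat_ne_top).mp h

end MeasureSets

section Levels

variable {n : ℕ} {I : CoerciveConvexFullDim n → CoerciveConvexFullDim n}

theorem measurableSet_sublevel (u : CoerciveConvexFullDim n) (t : ℝ) :
    MeasurableSet (sublevel u.1 t) := (u.2.isClosed_sublevel t).measurableSet

theorem isSolidBody_sublevel_iff (u : CoerciveConvexFullDim n) (t : ℝ) :
    IsSolidBody (sublevel u.1 t) ↔ volume (sublevel u.1 t) ≠ 0 :=
  ⟨fun h => h.measure_ne_zero,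
    isSolidBody_of_measure_ne_zero (u.2.convex_sublevel t) (u.2.isCompact_sublevel t)⟩

theorem volume_sublevel_eq
    (hI : ∀ u v t, volume (symmDiff (sublevel (I u).1 t) (sublevel (I v).1 t)) =
      volume (symmDiff (sublevel u.1 t) (sublevel v.1 t)))
    {t : ℝ} {w : CoerciveConvexFullDim n} (hw : sublevel w.1 t = ∅)
    (hIw : volume (sublevel (I w).1 t) = 0) (u : CoerciveConvexFullDim n) :
    volume (sublevel (I u).1 t) = volume (sublevel u.1 t) := by
  have h := hI u w t
  rw [hw, ← Set.bot_eq_empty, symmDiff_bot] at h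
  rw [← h]
  refine measure_congr ?_
  have h0 : sublevel (I w).1 t =ᵐ[volume] (∅ : Set _) := ae_eq_empty.mpr hIw
  have := (ae_eq_refl (sublevel (I u).1 t)).symmDiff h0
  rw [← Set.bot_eq_empty, symmDiff_bot] at this
  exact this.symm

/-- The sum of the two volumes is the volume of the symmetric difference plus twice that of the
intersection. -/
theorem volume_sublevel_inter_eq
    (hI : ∀ u v t, volume (symmDiff (sublevel (I u).1 t) (sublevel (I v).1 t)) =
      volume (symmDiff (sublevel u.1 t) (sublevel v.1 t)))
    {t : ℝ} {w : CoerciveConvexFullDim n} (hw : sublevel w.1 t = ∅)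
    (hIw : volume (sublevel (I w).1 t) = 0) (u v : CoerciveConvexFullDim n) :
    volume (sublevel (I u).1 t ∩ sublevel (I v).1 t) =
      volume (sublevel u.1 t ∩ sublevel v.1 t) := by
  apply ENNReal.eq_of_add_self_eq
  have h1 := measure_symmDiff_add_inter (μ := volume) (measurableSet_sublevel (I u) t)
    (measurableSet_sublevel (I v) t)
  rw [hI, volume_sublevel_eq hI hw hIw, volume_sublevel_eq hI hw hIw,
    ← measure_symmDiff_add_inter (measurableSet_sublevel u t) (measurableSet_sublevel v t)] at h1
  refine (ENNReal.add_right_inj (ne_top_of_le_ne_top ?_ (measure_mono symmDiff_le_sup))).mp h1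
  exact ((u.2.isCompact_sublevel t).union (v.2.isCompact_sublevel t)).measure_lt_top.ne

/-- At a level where the image of the empty sublevel set is null, `I` acts on sublevel sets by a
volume preserving affinity. -/
theorem exists_affineEquiv_sublevel (hn : 1 ≤ n)
    (hI : ∀ u v t, volume (symmDiff (sublevel (I u).1 t) (sublevel (I v).1 t)) =
      volume (symmDiff (sublevel u.1 t) (sublevel v.1 t)))
    {t : ℝ} {w : CoerciveConvexFullDim n} (hw : sublevel w.1 t = ∅)
    (hIw : volume (sublevel (I w).1 t) = 0) :
    ∃ A : EuclideanSpace ℝ (Fin n) ≃ᵃ[ℝ] EuclideanSpace ℝ (Fin n),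
      |LinearMap.det (A.linear : EuclideanSpace ℝ (Fin n) →ₗ[ℝ] EuclideanSpace ℝ (Fin n))| = 1 ∧
        ∀ u : CoerciveConvexFullDim n, IsSolidBody (sublevel u.1 t) →
          sublevel (I u).1 t = A '' sublevel u.1 t := by
  classical
  have : Nontrivial (EuclideanSpace ℝ (Fin n)) :=
    Module.nontrivial_of_finrank_pos (R := ℝ) (by rw [finrank_euclideanSpace_fin]; omega)
  let f : Set (EuclideanSpace ℝ (Fin n)) → Set (EuclideanSpace ℝ (Fin n)) := fun K =>
    if hK : IsSolidBody K then sublevel (I (constOnBody hK t)).1 t else K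
  have hfK : ∀ K (hK : IsSolidBody K), f K = sublevel (I (constOnBody hK t)).1 t :=
    fun K hK => dif_pos hK
  have hlev : ∀ (K : Set (EuclideanSpace ℝ (Fin n))) (hK : IsSolidBody K),
      sublevel (constOnBody hK t).1 t = K :=
    fun K hK => sublevel_constOn K le_rfl
  have hsolid : ∀ u : CoerciveConvexFullDim n, IsSolidBody (sublevel u.1 t) →
      IsSolidBody (sublevel (I u).1 t) := by
    intro u hu
    rw [isSolidBody_sublevel_iff, volume_sublevel_eq hI hw hIw]
    exact hu.measure_ne_zero
  have hf : PreservesInter volume f := by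
    constructor
    · intro K hK
      rw [hfK K hK]
      exact hsolid _ (by rwa [hlev K hK])
    · intro K L hK hL
      rw [hfK K hK, hfK L hL, volume_sublevel_inter_eq hI hw hIw, hlev K hK, hlev L hL]
  obtain ⟨A, hdet, hA⟩ := hf.exists_affineEquiv
  refine ⟨A, hdet, fun u hu => ?_⟩
  rw [← hA _ hu, hfK _ hu]
  -- Functions with the same t-sublevel set have images whose t-sublevel sets differ by a null set,
  -- so f does not depend on the representative.
  have h := hI u (constOnBody hu t) t
  rw [hlev _ hu, symmDiff_self, Set.bot_eq_empty, measure_empty, measure_symmDiff_eq_zero_iff] at h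
  rw [ae_eq_set] at h
  exact Set.Subset.antisymm
    ((hsolid u hu).subset_of_measure_diff (IsCoerciveConvexFullDim.isClosed_sublevel (I _).2 t) h.1)
    ((hsolid _ (by rwa [hlev _ hu])).subset_of_measure_diff
      (IsCoerciveConvexFullDim.isClosed_sublevel (I _).2 t) h.2)

/-- Empty sublevel sets are mapped to null sets. -/
theorem volume_sublevel_eq_zero (hn : 1 ≤ n)
    (hI : ∀ u v t, volume (symmDiff (sublevel (I u).1 t) (sublevel (I v).1 t)) =
      volume (symmDiff (sublevel u.1 t) (sublevel v.1 t)))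
    {t : ℝ} {w : CoerciveConvexFullDim n} (hw : sublevel w.1 t = ∅) :
    volume (sublevel (I w).1 t) = 0 := by
  by_contra hne
  have hE := (isSolidBody_sublevel_iff (I w) t).mpr hne
  have : Nontrivial (EuclideanSpace ℝ (Fin n)) :=
    Module.nontrivial_of_finrank_pos (R := ℝ) (by rw [finrank_euclideanSpace_fin]; omega)
  obtain ⟨c', hc'⟩ := (I w).2.exists_sublevel_eq_empty
  -- Far enough down, `I w` also has an empty sublevel set, so an affinity is available there.
  let c := min c' t
  have hct : c ≤ t := min_le_right _ _
  have hcw : sublevel w.1 c = ∅ := Set.subset_empty_iff.mp (hw ▸ sublevel_mono w.1 hct)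
  have hcIw : sublevel (I w).1 c = ∅ :=
    Set.subset_empty_iff.mp (hc' ▸ sublevel_mono (I w).1 (min_le_left _ _))
  obtain ⟨A, hdet, hA⟩ := exists_affineEquiv_sublevel hn hI hcw (by rw [hcIw, measure_empty])
  obtain ⟨R, hR0, hR⟩ := ((I w).2.isCompact_sublevel t).isBounded.subset_closedBall_lt 0 0
  -- A unit ball centred at norm R + 2 misses the assumed body, which lies in the ball of radius R.
  obtain ⟨z, hz⟩ := exists_norm_eq (EuclideanSpace ℝ (Fin n)) (show 0 ≤ R + 2 by linarith)
  let B := Metric.closedBall z 1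
  have hB : IsSolidBody B := isSolidBody_closedBall z one_pos
  have hBE : Disjoint B (sublevel (I w).1 t) := by
    refine Set.disjoint_left.mpr fun y hy hyE => ?_
    have h1 := hR hyE
    rw [mem_closedBall_zero_iff] at h1
    have h2 : ‖y - z‖ ≤ 1 := by simpa [B, dist_eq_norm] using hy
    have h3 := norm_sub_norm_le z y
    rw [norm_sub_rev] at h3
    linarith
  have hK : IsSolidBody (A.symm '' B) := hB.image_affineEquiv A.symm
  have hAK : A '' (A.symm '' B) = B := by
    rw [Set.image_image]
    simp
  let u := constOnBody hK c
  have huc : sublevel u.1 c = A.symm '' B := sublevel_constOn _ le_rfl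
  have hut : sublevel u.1 t = A.symm '' B := sublevel_constOn _ hct
  have hIuc : sublevel (I u).1 c = B := by
    rw [hA u (by rwa [huc]), huc, hAK]
  have hBF : B ⊆ sublevel (I u).1 t := hIuc ▸ sublevel_mono (I u).1 hct
  have hvol : volume (symmDiff (sublevel (I u).1 t) (sublevel (I w).1 t)) = volume B := by
    rw [hI, hw, ← Set.bot_eq_empty, symmDiff_bot, hut]
    have h1 := measure_image_affineMap volume A.toAffineMap (A.symm '' B)
    have h2 : A.toAffineMap '' (A.symm '' B) = B := hAK
    have h3 : |LinearMap.det A.toAffineMap.linear| = 1 := hdet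
    rw [h2, h3] at h1
    simpa using h1.symm
  have hBsub : B ⊆ symmDiff (sublevel (I u).1 t) (sublevel (I w).1 t) := fun y hy =>
    Or.inl ⟨hBF hy, Set.disjoint_left.mp hBE hy⟩
  -- The symmetric difference contains `B` and has the volume of `B`. Hence the t-sublevel set of `I
  -- u` is the disjoint union of `B` and that of `I w`, contradicting its connectedness.
  have hnull : volume (symmDiff (sublevel (I u).1 t) (sublevel (I w).1 t) \ B) = 0 := by
    rw [measure_sdiff hBsub hB.isCompact.measurableSet.nullMeasurableSet hB.measure_ne_top, hvol,
      tsub_self]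
  have hF : IsSolidBody (sublevel (I u).1 t) :=
    ⟨(I u).2.convex_sublevel t, (I u).2.isCompact_sublevel t,
      hB.interior_nonempty.mono (interior_mono hBF)⟩
  have hEF : sublevel (I w).1 t ⊆ sublevel (I u).1 t := by
    refine hE.subset_of_measure_diff (μ := volume) hF.isCompact.isClosed
      (measure_mono_null (fun y hy => ?_) hnull)
    exact ⟨Or.inr hy, fun hyB => hy.2 (hBF hyB)⟩
  have hFBE : sublevel (I u).1 t ⊆ B ∪ sublevel (I w).1 t := by
    refine hF.subset_of_measure_diff (μ := volume)
      (hB.isCompact.isClosed.union hE.isCompact.isClosed)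
      (measure_mono_null (fun y hy => ?_) hnull)
    exact ⟨Or.inl ⟨hy.1, fun h => hy.2 (Or.inr h)⟩, fun h => hy.2 (Or.inl h)⟩
  obtain ⟨e, he⟩ := hE.interior_nonempty.mono interior_subset
  obtain ⟨y, -, hy1, hy2⟩ := isPreconnected_closed_iff.mp hF.convex.isPreconnected _ _
    hB.isCompact.isClosed hE.isCompact.isClosed hFBE
    ⟨z, hBF (Metric.mem_closedBall_self zero_le_one), Metric.mem_closedBall_self zero_le_one⟩
    ⟨e, hEF he, he⟩
  exact Set.disjoint_left.mp hBE hy1 hy2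

/-- All sublevel sets are transformed by one volume preserving affinity. -/
theorem exists_affineEquiv_forall_sublevel (hn : 1 ≤ n)
    (hI : ∀ u v t, volume (symmDiff (sublevel (I u).1 t) (sublevel (I v).1 t)) =
      volume (symmDiff (sublevel u.1 t) (sublevel v.1 t))) :
    ∃ A : EuclideanSpace ℝ (Fin n) ≃ᵃ[ℝ] EuclideanSpace ℝ (Fin n),
      |LinearMap.det (A.linear : EuclideanSpace ℝ (Fin n) →ₗ[ℝ] EuclideanSpace ℝ (Fin n))| = 1 ∧
        ∀ (u : CoerciveConvexFullDim n) (t : ℝ), sublevel (I u).1 t = A '' sublevel u.1 t := by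
  have hball : IsSolidBody (Metric.closedBall (0 : EuclideanSpace ℝ (Fin n)) 1) :=
    isSolidBody_closedBall 0 one_pos
  have hw : ∀ t : ℝ, sublevel (constOnBody hball (t + 1)).1 t = ∅ :=
    fun t => sublevel_constOn_of_lt _ (lt_add_one t)
  have hlevel := fun t => exists_affineEquiv_sublevel hn hI (hw t)
    (volume_sublevel_eq_zero hn hI (hw t))
  have hvol := fun t => volume_sublevel_eq hI (hw t) (volume_sublevel_eq_zero hn hI (hw t))
  choose A hdet hA using hlevel
  -- The function equal to `c` on `K` has sublevel set `K` at both levels; the image sublevel sets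
  -- are nested and of equal volume.
  have hle : ∀ c t : ℝ, c ≤ t → ∀ K, IsSolidBody K → A c '' K = A t '' K := by
    intro c t hct K hK
    have h1 : sublevel (constOnBody hK c).1 c = K := sublevel_constOn K le_rfl
    have h2 : sublevel (constOnBody hK c).1 t = K := sublevel_constOn K hct
    have h3 := hA c (constOnBody hK c) (by rwa [h1])
    have h4 := hA t (constOnBody hK c) (by rwa [h2])
    rw [h1] at h3
    rw [h2] at h4
    rw [← h3, ← h4]
    refine IsSolidBody.eq_of_subset_of_measure_le (μ := volume)
      ?_ ((I _).2.isClosed_sublevel c) (sublevel_mono _ hct) ?_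
    · rw [h4]
      exact hK.image_affineEquiv _
    · rw [hvol, hvol, h1, h2]
  have hzero : ∀ (u : CoerciveConvexFullDim n) (t : ℝ), IsSolidBody (sublevel u.1 t) →
      sublevel (I u).1 t = A 0 '' sublevel u.1 t := by
    intro u t hu
    rw [hA t u hu]
    rcases le_total 0 t with h | h
    · exact (hle 0 t h _ hu).symm
    · exact hle t 0 h _ hu
  refine ⟨A 0, hdet 0, fun u t => ?_⟩
  -- The set at level t may be degenerate. It is the intersection of those at levels s > t, which
  -- are solid if it is nonempty.
  have key : ∀ x, A 0 x ∈ sublevel (I u).1 t ↔ x ∈ sublevel u.1 t := by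
    intro x
    have hmem : ∀ (v : CoerciveConvexFullDim n) (y : EuclideanSpace ℝ (Fin n)),
        (∀ s, t < s → y ∈ sublevel v.1 s) → y ∈ sublevel v.1 t := by
      intro v y h
      refine EReal.le_of_forall_lt_iff_le.mp fun s hs => ?_
      exact h s (EReal.coe_lt_coe_iff.mp hs)
    constructor
    · refine fun hx => hmem u x fun s hs => ?_
      have h1 := (I u).2.isSolidBody_sublevel ⟨_, hx⟩ hs
      rw [isSolidBody_sublevel_iff, hvol, ← isSolidBody_sublevel_iff] at h1
      have h2 := sublevel_mono (I u).1 hs.le hx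
      rw [hzero u s h1] at h2
      exact (A 0).injective.mem_set_image.mp h2
    · refine fun hx => hmem (I u) _ fun s hs => ?_
      rw [hzero u s (u.2.isSolidBody_sublevel ⟨_, hx⟩ hs)]
      exact Set.mem_image_of_mem _ (sublevel_mono u.1 hs.le hx)
  ext y
  obtain ⟨x, rfl⟩ := (A 0).surjective y
  rw [key, (A 0).injective.mem_set_image]

end Levels

/-! ### Volume preserving affinities are isometries, and conclusion -/

section Converse

variable {n : ℕ}

theorem measurePreserving_affinity
    {φ : EuclideanSpace ℝ (Fin n) ≃ₗ[ℝ] EuclideanSpace ℝ (Fin n)} {x₀ : EuclideanSpace ℝ (Fin n)}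
    (hφ : |LinearMap.det (φ : EuclideanSpace ℝ (Fin n) →ₗ[ℝ] EuclideanSpace ℝ (Fin n))| = 1) :
    MeasurePreserving (affinity φ x₀) := by
  have h1 : MeasurePreserving (φ : EuclideanSpace ℝ (Fin n) →ₗ[ℝ] EuclideanSpace ℝ (Fin n)) := by
    refine ⟨(LinearMap.continuous_of_finiteDimensional _).measurable, ?_⟩
    rw [Measure.map_linearMap_addHaar_eq_smul_addHaar _ (fun h => by simp [h] at hφ), abs_inv, hφ]
    simp
  exact (measurePreserving_add_right volume x₀).comp h1

theorem isDeltaIsometry_of_eq_comp_affinity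
    {I : CoerciveConvexFullDim n → CoerciveConvexFullDim n}
    {φ : EuclideanSpace ℝ (Fin n) ≃ₗ[ℝ] EuclideanSpace ℝ (Fin n)} {x₀ : EuclideanSpace ℝ (Fin n)}
    (hφ : |LinearMap.det (φ : EuclideanSpace ℝ (Fin n) →ₗ[ℝ] EuclideanSpace ℝ (Fin n))| = 1)
    (hI : ∀ u : CoerciveConvexFullDim n, (I u).1 = u.1 ∘ (affinity φ x₀).symm)
    {ζ : ℝ → ℝ} (hζ : Continuous ζ) : IsDeltaIsometry ζ I := by
  intro u v
  rw [deltaZeta_eq_lintegral, deltaZeta_eq_lintegral]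
  have hm : Measurable fun x => ‖zetaEval ζ ((I u).1 x) - zetaEval ζ ((I v).1 x)‖ₑ :=
    ((measurable_zetaEval_comp hζ (I u)).sub (measurable_zetaEval_comp hζ (I v))).enorm
  rw [← (measurePreserving_affinity (x₀ := x₀) hφ).lintegral_comp hm]
  simp [hI]

end Converse

theorem mainTheorem3 (n : ℕ) (hn : 1 ≤ n)
    (I : CoerciveConvexFullDim n → CoerciveConvexFullDim n) :
    (∀ ζ : ℝ → ℝ, IsMomentClass n ζ → IsDeltaIsometry ζ I) ↔
      ∃ (φ : EuclideanSpace ℝ (Fin n) ≃ₗ[ℝ] EuclideanSpace ℝ (Fin n))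
        (x₀ : EuclideanSpace ℝ (Fin n)),
        |LinearMap.det (φ : EuclideanSpace ℝ (Fin n) →ₗ[ℝ] EuclideanSpace ℝ (Fin n))| = 1 ∧
          ∀ u : CoerciveConvexFullDim n, (I u).1 = u.1 ∘ (affinity φ x₀).symm := by
  constructor
  · intro hI
    obtain ⟨A, hdet, hA⟩ := exists_affineEquiv_forall_sublevel hn (volume_symmDiff_sublevel hn hI)
    refine ⟨A.linear, A 0, hdet, fun u => ?_⟩
    have haff : ∀ x, affinity A.linear (A 0) x = A x := by
      intro x
      simpa [affinity_apply] using (A.map_vadd 0 x).symm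
    ext y
    obtain ⟨x, rfl⟩ := (affinity A.linear (A 0)).surjective y
    rw [Function.comp_apply, Equiv.symm_apply_apply, haff]
    refine eq_of_forall_ge_iff fun s => ?_
    induction s with
    | bot => simp [(I u).2.ne_bot, u.2.ne_bot]
    | coe t => rw [← mem_sublevel, hA, A.injective.mem_set_image, mem_sublevel]
    | top => simp
  · rintro ⟨φ, x₀, hφ, hI⟩ ζ hζ
    exact isDeltaIsometry_of_eq_comp_affinity hφ hI hζ.continuous
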